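/- Let $r_1,r_2\in\{\frac12,\frac13,\frac14,\frac16\}$ or $(r_1,r_2)\in\{(\frac15,\frac25),(\frac18,\frac38),(\frac1{10},\frac3{10}),(\frac1{12},\frac5{12})\}$, and let $d$ be the least common denominator of $r_1,r_2$. For a positive integer $N$ put $$H(N)=H_{r_1,r_2}(N)=\sum_{k=0}^{N-1}\frac{(r_1)_k(1-r_1)_k(r_2)_k(1-r_2)_k}{k!^4},\qquad (a)_k=a(a+1)\cdots(a+k-1).$$ For a positive integer $m$ and rational numbers $x,y$, write $x\equiv y\pmod m$ if $x-y=a/b$ for integers $a,b$ with $b\ne0$, $m\mid a$ and $\gcd(b,m)=1$. Let $p$ be a prime with $p\nmid d$ and $H(p)\not\equiv0\pmod p$. Then for every integer $s\ge1$, $$\frac{H(p^{s+1})}{H(p^s)}\equiv\frac{H(p^s)}{H(p^{s-1})}\pmod{p^3}.$$ -/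

import Mathlib

/-- Congruence of rational numbers modulo a positive integer `m`: the difference `x - y` can be
written as a fraction whose numerator is divisible by `m` and whose denominator is coprime
with `m`. -/
def RatCongr (m : ℕ) (x y : ℚ) : Prop :=
  ∃ a b : ℤ, b ≠ 0 ∧ x - y = (a : ℚ) / (b : ℚ) ∧ (m : ℤ) ∣ a ∧ IsCoprime b (m : ℤ)

/-- The admissible pairs of parameters: both entries in `{1/2, 1/3, 1/4, 1/6}` (in any order), or
one of four exceptional pairs. -/
def AdmissiblePair (r₁ r₂ : ℚ) : Prop :=
  (r₁ ∈ ({1 / 2, 1 / 3, 1 / 4, 1 / 6} : Set ℚ) ∧ r₂ ∈ ({1 / 2, 1 / 3, 1 / 4, 1 / 6} : Set ℚ)) ∨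
    (r₁, r₂) ∈ ({(1 / 5, 2 / 5), (1 / 8, 3 / 8), (1 / 10, 3 / 10), (1 / 12, 5 / 12)} : Set (ℚ × ℚ))

/-- The least common denominator of `r₁` and `r₂`. -/
def commonDen (r₁ r₂ : ℚ) : ℕ := Nat.lcm r₁.den r₂.den

/-- The shifted factorial `(a)_k = a (a + 1) ⋯ (a + k - 1)`. -/
noncomputable def shiftedFactorial (a : ℚ) (k : ℕ) : ℚ := (ascPochhammer ℚ k).eval a

/-- The truncated hypergeometric sum
`∑_{k < N} (r₁)_k (1 - r₁)_k (r₂)_k (1 - r₂)_k / k!^4`. -/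
noncomputable def truncH (r₁ r₂ : ℚ) (N : ℕ) : ℚ :=
  ∑ k ∈ Finset.range N,
    (shiftedFactorial r₁ k * shiftedFactorial (1 - r₁) k *
      shiftedFactorial r₂ k * shiftedFactorial (1 - r₂) k) / (Nat.factorial k : ℚ) ^ 4

/-!
Write `H(N)` for the truncated sum, `A(k)` for its summand and `x ≡ y` for congruence modulo
`p³ ℤ_(p)`. The theorem follows from `H(p^{s+1}) ≡ H(p) H(p^s)`
(`FrobeniusData.ratCongr_of_block`), since `H(p)`, and hence every `H(p^s)`, is a `p`-adic unit.

Dwork's operation sends a parameter `r` to `r' = (r + m) / p` with `0 ≤ m < p`. It permutes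
`r₁, 1 - r₁, r₂, 1 - r₂` (`FrobeniusData.nonempty_of_admissible`), so `A(p n + a) = A(n) g(n, a)`
with an explicit `p`-integral `g` (`FrobeniusData.hTerm_add`). It therefore suffices that the sum
`G(n) = ∑_{a < p} g(n, a)` over a block does not depend on `n` modulo `p³`.

Let `p ≥ 5` and `x = p n`. The part of `g` independent of `a` is a product of `n` block factors; for
each pair `r, 1 - r` it is congruent to `(r - x)_m / (r + x)_m`, because this quotient satisfies the
same recurrence up to a defect which Wolstenholme's congruence for `(1 + x)_{p-1}` makes trivial
(`blockFactor_mul`, `prod_blockFactor_pcongr`). So `G(n)` is congruent to a quadratic polynomial in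
`p r₁'`, `p r₂'` and `x`. The coefficient of `x` matters modulo `p²` only, where it is affine in the
parameters, so constancy in `x` can be checked at three affinely independent points
(`IsQuadratic.pcongr_of_nodes`): `r_i' ∈ {0, 1}`, where the `r_i` are integers.

The reflection `r ↦ 1 - r` reduces these to `r_i = -m_i`. Then the factor of the summand belonging
to `r_i` is, with `t = x + a`, exactly `±x (t + 1)_m / (t - m)_{m+1}`, a combination of simple
fractions `x / (t - i)` with `0 ≤ i ≤ m` and `p`-integral coefficients. The sums
`∑_a x² / ((x + a - i) (x + a - j))` are congruent to `1` for `i = j` and to `0` otherwise, as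
`∑ 1 / b` and `∑ 1 / b²` over the nonzero residues vanish modulo `p`
(`sum_simple_fractions_pcongr`). This gives a constant independent of `n ≥ 1`, and `n = 0` follows
by continuity.

For `p = 2` and `p = 3` the quantity `G(n)` is only constant modulo `p²`, but it deviates from
`G(0)` modulo `p³` only where `p ∣ A(n)`. This is a statement about residues modulo `p³`, verified
for each pair of parameters by a finite computation (`FrobeniusData.block_pcongr_of_check`).
-/

/-! ### Rational numbers integral at a prime -/

/-- The subring `ℤ_(p)` of `ℚ`: fractions whose denominator is coprime with `p`. -/
def pIntegral (p : ℕ) : Subring ℚ where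
  carrier := {x | ∃ a b : ℤ, b ≠ 0 ∧ IsCoprime b (p : ℤ) ∧ x = a / b}
  mul_mem' := by
    rintro _ _ ⟨a, b, hb, hbp, rfl⟩ ⟨c, d, hd, hdp, rfl⟩
    exact ⟨a * c, b * d, mul_ne_zero hb hd, hbp.mul_left hdp, by
      push_cast; rw [div_mul_div_comm]⟩
  one_mem' := ⟨1, 1, one_ne_zero, isCoprime_one_left, by simp⟩
  add_mem' := by
    rintro _ _ ⟨a, b, hb, hbp, rfl⟩ ⟨c, d, hd, hdp, rfl⟩
    have hb' : (b : ℚ) ≠ 0 := by exact_mod_cast hb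
    have hd' : (d : ℚ) ≠ 0 := by exact_mod_cast hd
    exact ⟨a * d + b * c, b * d, mul_ne_zero hb hd, hbp.mul_left hdp, by
      push_cast; rw [div_add_div _ _ hb' hd']⟩
  zero_mem' := ⟨0, 1, one_ne_zero, isCoprime_one_left, by simp⟩
  neg_mem' := by
    rintro _ ⟨a, b, hb, hbp, rfl⟩
    exact ⟨-a, b, hb, hbp, by push_cast; rw [neg_div]⟩

/-- The rational number `x` is a unit of `ℤ_(p)`. -/
def IsPUnit (p : ℕ) (x : ℚ) : Prop := x ≠ 0 ∧ x ∈ pIntegral p ∧ x⁻¹ ∈ pIntegral p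

/-- `x ≡ y` modulo `p ^ k ℤ_(p)`. The numbers `x` and `y` need not be `p`-integral. -/
def PCongr (p k : ℕ) (x y : ℚ) : Prop := ∃ z ∈ pIntegral p, x - y = (p : ℚ) ^ k * z

lemma ratCongr_pow_iff {p k : ℕ} (hk : k ≠ 0) (x y : ℚ) :
    RatCongr (p ^ k) x y ↔ PCongr p k x y := by
  constructor
  · rintro ⟨a, b, hb, h, ⟨c, rfl⟩, hc⟩
    refine ⟨c / b, ⟨c, b, hb, ?_, rfl⟩, by rw [h]; push_cast; ring⟩
    push_cast at hc
    exact (IsCoprime.pow_right_iff (Nat.pos_of_ne_zero hk)).1 hc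
  · rintro ⟨_, ⟨c, b, hb, hc, rfl⟩, h⟩
    refine ⟨p ^ k * c, b, hb, by rw [h]; push_cast; ring, ⟨c, by push_cast; ring⟩, ?_⟩
    push_cast
    exact hc.pow_right

section
variable {p : ℕ}

lemma intCast_mem_pIntegral (n : ℤ) : (n : ℚ) ∈ pIntegral p := intCast_mem _ n

lemma natCast_mem_pIntegral (n : ℕ) : (n : ℚ) ∈ pIntegral p := natCast_mem _ n

lemma IsPUnit.mul {x y : ℚ} (hx : IsPUnit p x) (hy : IsPUnit p y) : IsPUnit p (x * y) :=
  ⟨mul_ne_zero hx.1 hy.1, mul_mem hx.2.1 hy.2.1, by rw [mul_inv]; exact mul_mem hx.2.2 hy.2.2⟩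

lemma isPUnit_one : IsPUnit p 1 := ⟨one_ne_zero, one_mem _, by rw [inv_one]; exact one_mem _⟩

lemma IsPUnit.pow {x : ℚ} (hx : IsPUnit p x) (k : ℕ) : IsPUnit p (x ^ k) := by
  induction k with
  | zero => simpa using isPUnit_one
  | succ k ih => rw [pow_succ]; exact ih.mul hx

lemma IsPUnit.inv {x : ℚ} (hx : IsPUnit p x) : IsPUnit p x⁻¹ :=
  ⟨inv_ne_zero hx.1, hx.2.2, by rw [inv_inv]; exact hx.2.1⟩

/-- An integer prime to `p` stays a unit after adding an element of `p ℤ_(p)`. -/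
lemma isPUnit_int_add {i : ℤ} (hi : IsCoprime i (p : ℤ)) (hp : p.Prime) {z : ℚ}
    (hz : z ∈ pIntegral p) : IsPUnit p (i + p * z) := by
  obtain ⟨c, b, hb, hbp, rfl⟩ := hz
  have hb' : (b : ℚ) ≠ 0 := by exact_mod_cast hb
  have hcop : IsCoprime (i * b + p * c) (p : ℤ) := by
    have := (hi.mul_left hbp).add_mul_left_left c
    simpa using this
  have h0 : i * b + p * c ≠ 0 := by
    intro h
    rw [h, isCoprime_zero_left, Int.isUnit_iff] at hcop
    have := hp.two_le
    omega
  have h0' : (i * b + p * c : ℚ) ≠ 0 := by exact_mod_cast h0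
  have heq : (i + p * (c / b) : ℚ) = (i * b + p * c) / b := by field_simp
  rw [heq]
  refine ⟨div_ne_zero h0' hb', ⟨i * b + p * c, b, hb, hbp, by push_cast; rfl⟩,
    ⟨b, i * b + p * c, h0, hcop, by rw [inv_div]; push_cast; rfl⟩⟩

lemma isPUnit_int {i : ℤ} (hi : IsCoprime i (p : ℤ)) (hp : p.Prime) : IsPUnit p (i : ℚ) := by
  simpa using isPUnit_int_add hi hp (zero_mem _)

lemma isCoprime_of_abs_lt (hp : p.Prime) {i : ℤ} (h0 : i ≠ 0) (h : |i| < p) :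
    IsCoprime i (p : ℤ) := by
  rw [isCoprime_comm, (Nat.prime_iff_prime_int.1 hp).coprime_iff_not_dvd]
  intro hd
  exact h0 (Int.eq_zero_of_abs_lt_dvd hd h)

lemma pIntegral_isPUnit_or (hp : p.Prime) {x : ℚ} (hx : x ∈ pIntegral p) :
    IsPUnit p x ∨ PCongr p 1 x 0 := by
  obtain ⟨a, b, hb, hbp, rfl⟩ := hx
  by_cases ha : IsCoprime a (p : ℤ)
  · left
    rw [div_eq_mul_inv]
    exact (isPUnit_int ha hp).mul (isPUnit_int hbp hp).inv
  · right
    rw [isCoprime_comm, (Nat.prime_iff_prime_int.1 hp).coprime_iff_not_dvd, not_not] at ha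
    obtain ⟨c, rfl⟩ := ha
    exact ⟨c / b, ⟨c, b, hb, hbp, rfl⟩, by push_cast; ring⟩

lemma PCongr.of_eq {k : ℕ} {x y : ℚ} (h : x = y) : PCongr p k x y :=
  ⟨0, zero_mem _, by simp [h]⟩

lemma PCongr.refl (k : ℕ) (x : ℚ) : PCongr p k x x := .of_eq rfl

lemma PCongr.symm {k : ℕ} {x y : ℚ} (h : PCongr p k x y) : PCongr p k y x := by
  obtain ⟨z, hz, h⟩ := h
  exact ⟨-z, neg_mem hz, by linear_combination -h⟩

lemma PCongr.trans {k : ℕ} {x y w : ℚ} (h : PCongr p k x y) (h' : PCongr p k y w) :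
    PCongr p k x w := by
  obtain ⟨z, hz, h⟩ := h
  obtain ⟨z', hz', h'⟩ := h'
  exact ⟨z + z', add_mem hz hz', by linear_combination h + h'⟩

lemma PCongr.add {k : ℕ} {x y x' y' : ℚ} (h : PCongr p k x y) (h' : PCongr p k x' y') :
    PCongr p k (x + x') (y + y') := by
  obtain ⟨z, hz, h⟩ := h
  obtain ⟨z', hz', h'⟩ := h'
  exact ⟨z + z', add_mem hz hz', by linear_combination h + h'⟩

lemma PCongr.mul_left {k : ℕ} {x y c : ℚ} (hc : c ∈ pIntegral p) (h : PCongr p k x y) :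
    PCongr p k (c * x) (c * y) := by
  obtain ⟨z, hz, h⟩ := h
  exact ⟨c * z, mul_mem hc hz, by linear_combination c * h⟩

lemma PCongr.mul {k : ℕ} {x y x' y' : ℚ} (hx' : x' ∈ pIntegral p) (hy : y ∈ pIntegral p)
    (h : PCongr p k x y) (h' : PCongr p k x' y') : PCongr p k (x * x') (y * y') := by
  have h1 := h.mul_left hx'
  have h2 := h'.mul_left hy
  rw [mul_comm x' x, mul_comm x' y] at h1
  exact h1.trans h2

lemma PCongr.sum {ι : Type*} {k : ℕ} {s : Finset ι} {f g : ι → ℚ}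
    (h : ∀ i ∈ s, PCongr p k (f i) (g i)) : PCongr p k (∑ i ∈ s, f i) (∑ i ∈ s, g i) := by
  classical
  induction s using Finset.induction_on with
  | empty => exact .of_eq (by simp)
  | insert a s ha ih =>
    rw [Finset.sum_insert ha, Finset.sum_insert ha]
    exact (h a (by simp)).add (ih fun i hi => h i (by simp [hi]))

lemma PCongr.mem {k : ℕ} {x y : ℚ} (h : PCongr p k x y) (hy : y ∈ pIntegral p) :
    x ∈ pIntegral p := by
  obtain ⟨z, hz, h⟩ := h
  rw [sub_eq_iff_eq_add] at h
  rw [h]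
  exact add_mem (mul_mem (pow_mem (natCast_mem_pIntegral p) k) hz) hy

lemma PCongr.of_le {j k : ℕ} (hjk : j ≤ k) {x y : ℚ} (h : PCongr p k x y) : PCongr p j x y := by
  obtain ⟨z, hz, h⟩ := h
  refine ⟨p ^ (k - j) * z, mul_mem (pow_mem (natCast_mem_pIntegral p) _) hz, ?_⟩
  rw [h, ← mul_assoc, ← pow_add, Nat.add_sub_cancel' hjk]

lemma PCongr.mul_of_zero {j k : ℕ} {x y : ℚ} (hx : PCongr p j x 0) (hy : PCongr p k y 0) :
    PCongr p (j + k) (x * y) 0 := by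
  obtain ⟨z, hz, h⟩ := hx
  obtain ⟨z', hz', h'⟩ := hy
  rw [sub_zero] at h h'
  exact ⟨z * z', mul_mem hz hz', by rw [h, h', pow_add]; ring⟩

lemma pcongr_sub_zero_iff {k : ℕ} {x y : ℚ} : PCongr p k (x - y) 0 ↔ PCongr p k x y := by
  unfold PCongr; simp

/-- A number congruent to a unit modulo `p` is a unit, because `1` is not divisible by `p` in
`ℤ_(p)`. -/
lemma PCongr.isPUnit (hp : p.Prime) {k : ℕ} (hk : k ≠ 0) {x y : ℚ} (h : PCongr p k x y)
    (hy : IsPUnit p y) : IsPUnit p x := by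
  rcases pIntegral_isPUnit_or hp (h.mem hy.2.1) with h1 | h1
  · exact h1
  · exfalso
    have h2 : PCongr p 1 y 0 := (h.of_le (Nat.one_le_iff_ne_zero.2 hk)).symm.trans h1
    have h3 := h2.mul_left hy.2.2
    rw [inv_mul_cancel₀ hy.1, mul_zero] at h3
    obtain ⟨_, ⟨a, b, hb, hbp, rfl⟩, h3⟩ := h3
    have hb' : (b : ℚ) ≠ 0 := by exact_mod_cast hb
    have h4 : (b : ℚ) = p * a := by field_simp at h3; linarith
    have h5 : b = p * a := by exact_mod_cast h4
    rw [h5] at hbp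
    have h6 := hbp.of_mul_left_left
    rw [isCoprime_self, Int.isUnit_iff] at h6
    have := hp.two_le
    omega

/-- Units may be divided out of a congruence. -/
lemma PCongr.of_mul_left {k : ℕ} {x y c : ℚ} (hc : IsPUnit p c) (h : PCongr p k (c * x) (c * y)) :
    PCongr p k x y := by
  have := h.mul_left hc.2.2
  rwa [← mul_assoc, ← mul_assoc, inv_mul_cancel₀ hc.1, one_mul, one_mul] at this

lemma PCongr.inv {k : ℕ} {x y : ℚ} (hx : IsPUnit p x) (hy : IsPUnit p y) (h : PCongr p k x y) :
    PCongr p k x⁻¹ y⁻¹ := by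
  refine PCongr.of_mul_left (hx.mul hy) ?_
  have h1 : x * y * x⁻¹ = y := by have := hx.1; field_simp
  have h2 : x * y * y⁻¹ = x := by have := hy.1; field_simp
  rw [h1, h2]
  exact h.symm

end

/-! ### Shifted factorials -/

@[simp] lemma shiftedFactorial_zero (a : ℚ) : shiftedFactorial a 0 = 1 := by
  simp [shiftedFactorial]

lemma shiftedFactorial_succ (a : ℚ) (k : ℕ) :
    shiftedFactorial a (k + 1) = shiftedFactorial a k * (a + k) := by
  simp [shiftedFactorial, ascPochhammer_succ_eval]

lemma shiftedFactorial_add (a : ℚ) (j k : ℕ) :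
    shiftedFactorial a (j + k) = shiftedFactorial a j * shiftedFactorial (a + j) k := by
  induction k with
  | zero => simp
  | succ k ih =>
    rw [← add_assoc, shiftedFactorial_succ, shiftedFactorial_succ, ih]
    push_cast
    ring

lemma shiftedFactorial_succ_left (a : ℚ) (k : ℕ) :
    shiftedFactorial a (k + 1) = a * shiftedFactorial (a + 1) k := by
  rw [add_comm k 1, shiftedFactorial_add]
  simp [shiftedFactorial_succ]

lemma shiftedFactorial_reflect (a : ℚ) (k : ℕ) :
    shiftedFactorial (1 - k - a) k = (-1) ^ k * shiftedFactorial a k := by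
  induction k with
  | zero => simp
  | succ k ih =>
    rw [shiftedFactorial_succ_left, shiftedFactorial_succ,
      show (1 - ((k + 1 : ℕ) : ℚ) - a + 1) = 1 - k - a by push_cast; ring, ih]
    push_cast
    ring

lemma shiftedFactorial_eq_prod (a : ℚ) (k : ℕ) :
    shiftedFactorial a k = ∏ i ∈ Finset.range k, (a + i) := by
  induction k with
  | zero => simp
  | succ k ih => rw [shiftedFactorial_succ, ih, Finset.prod_range_succ]

lemma shiftedFactorial_one_eq (k : ℕ) : shiftedFactorial 1 k = k.factorial := by
  induction k with
  | zero => simp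
  | succ k ih => rw [shiftedFactorial_succ, ih, Nat.factorial_succ]; push_cast; ring

lemma shiftedFactorial_mem {p : ℕ} {a : ℚ} (ha : a ∈ pIntegral p) (k : ℕ) :
    shiftedFactorial a k ∈ pIntegral p := by
  rw [shiftedFactorial_eq_prod]
  exact prod_mem fun i _ => add_mem ha (natCast_mem_pIntegral i)

lemma isPUnit_shiftedFactorial {p : ℕ} {a : ℚ} {k : ℕ} (h : ∀ i < k, IsPUnit p (a + i)) :
    IsPUnit p (shiftedFactorial a k) := by
  induction k with
  | zero => simpa using isPUnit_one
  | succ k ih =>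
    rw [shiftedFactorial_succ]
    exact (ih fun i hi => h i (by omega)).mul (h k (by omega))

/-! ### Splitting the summand along residues modulo `p` -/

/-- The factor `(r)_k (1 - r)_k / k!²` of the summand. -/
noncomputable def pairTerm (r : ℚ) (k : ℕ) : ℚ :=
  shiftedFactorial r k * shiftedFactorial (1 - r) k / shiftedFactorial 1 k ^ 2

/-- The summand of `truncH`. -/
noncomputable def hTerm (r₁ r₂ : ℚ) (k : ℕ) : ℚ := pairTerm r₁ k * pairTerm r₂ k

/-- The shifted summand `(r + x)_a (1 - r + x)_a / (1 + x)_a²`. -/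
noncomputable def shiftTerm (r x : ℚ) (a : ℕ) : ℚ :=
  shiftedFactorial (r + x) a * shiftedFactorial (1 - r + x) a / shiftedFactorial (1 + x) a ^ 2

/-- With `p = m + 1 + m'`, the product of the factors `y + i`, `0 ≤ i < p`, without `i = m`. -/
noncomputable def punctured (y : ℚ) (m m' : ℕ) : ℚ :=
  shiftedFactorial y m * shiftedFactorial (y + m + 1) m'

/-- The contribution of the block of indices `x, …, x + p - 1`, where `p = m + 1 + m'`, to the
quotient of a summand at `p n` by the summand at `n`. -/
noncomputable def blockFactor (r x : ℚ) (m m' : ℕ) : ℚ :=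
  punctured (r + x) m m' * punctured (1 - r + x) m' m / shiftedFactorial (1 + x) (m + m') ^ 2

lemma truncH_eq_sum (r₁ r₂ : ℚ) (N : ℕ) : truncH r₁ r₂ N = ∑ k ∈ Finset.range N, hTerm r₁ r₂ k := by
  unfold truncH hTerm pairTerm
  refine Finset.sum_congr rfl fun k _ => ?_
  rw [shiftedFactorial_one_eq, div_mul_div_comm]
  ring

lemma pairTerm_one_sub (r : ℚ) (k : ℕ) : pairTerm (1 - r) k = pairTerm r k := by
  unfold pairTerm; rw [sub_sub_cancel, mul_comm (shiftedFactorial (1 - r) k)]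

lemma shiftTerm_one_sub (r x : ℚ) (a : ℕ) : shiftTerm (1 - r) x a = shiftTerm r x a := by
  unfold shiftTerm; rw [sub_sub_cancel, mul_comm (shiftedFactorial (1 - r + x) a)]

lemma blockFactor_one_sub (r x : ℚ) (m m' : ℕ) :
    blockFactor (1 - r) x m' m = blockFactor r x m m' := by
  unfold blockFactor
  rw [sub_sub_cancel, mul_comm (punctured (1 - r + x) m' m), add_comm m' m]

lemma hTerm_zero (r₁ r₂ : ℚ) : hTerm r₁ r₂ 0 = 1 := by simp [hTerm, pairTerm]

/-- Among `p` consecutive factors of `(r)_{p (n + 1)}` the one divisible by `p` is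
`p (r' + n)`, where `p r' = r + m`; it supplies the last factor of `(r')_{n + 1}`. -/
lemma shiftedFactorial_mul_block {p m m' : ℕ} (hm : p = m + 1 + m') {r r' : ℚ}
    (hr : p * r' = r + m) (n : ℕ) :
    shiftedFactorial r (p * n) =
      p ^ n * shiftedFactorial r' n *
        ∏ l ∈ Finset.range n, punctured (r + p * l) m m' := by
  induction n with
  | zero => simp
  | succ n ih =>
    rw [mul_add, mul_one, shiftedFactorial_add, ih, Finset.prod_range_succ, shiftedFactorial_succ]
    have : shiftedFactorial (r + (p * n : ℕ)) p
        = punctured (r + p * n) m m' * (p * (r' + n)) := by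
      have split : ∀ y, shiftedFactorial y p = punctured y m m' * (y + m) := by
        intro y
        rw [hm, shiftedFactorial_add, shiftedFactorial_succ, punctured]
        push_cast
        rw [← add_assoc]
        ring
      have e : p * (r' + n) = r + p * n + m := by rw [mul_add, hr]; ring
      rw [split, e]
      push_cast
      ring
    rw [this]
    ring

lemma shiftedFactorial_one_add_nat_ne_zero (n k : ℕ) : shiftedFactorial (1 + n) k ≠ 0 := by
  rw [shiftedFactorial_eq_prod, Finset.prod_ne_zero_iff]
  intro i _
  positivity

/-- Dwork's factorization of the summand at `a + p n`: the summand at `n` with the parameters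
`r'` instead of `r`, times factors that are analytic in `p n`. -/
lemma pairTerm_add_mul {p m m' : ℕ} (hp : p.Prime) (hm : p = m + 1 + m') {r r' : ℚ}
    (hr : p * r' = r + m) (n a : ℕ) :
    pairTerm r (p * n + a) = pairTerm r' n *
      (∏ l ∈ Finset.range n, blockFactor r (p * l) m m') * shiftTerm r (p * n) a := by
  have hp0 : (p : ℚ) ≠ 0 := by exact_mod_cast hp.ne_zero
  have hr' : p * (1 - r') = (1 - r) + m' := by
    rw [mul_sub, hr, mul_one]; rw [hm]; push_cast; ring
  have h1 : (p : ℚ) * 1 = 1 + (m + m' : ℕ) := by rw [hm]; push_cast; ring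
  have e1 := shiftedFactorial_mul_block hm hr n
  have e2 := shiftedFactorial_mul_block (m := m') (m' := m) (by omega) hr' n
  have e3 := shiftedFactorial_mul_block (m := m + m') (m' := 0) (by omega) h1 n
  simp only [punctured, shiftedFactorial_zero, mul_one] at e3
  simp only [pairTerm, shiftTerm, blockFactor, shiftedFactorial_add, e1, e2, e3,
    Finset.prod_div_distrib, Finset.prod_mul_distrib, Finset.prod_pow]
  have n1 : shiftedFactorial 1 n ≠ 0 := by simpa using shiftedFactorial_one_add_nat_ne_zero 0 n
  have n2 : shiftedFactorial (1 + p * n) a ≠ 0 := by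
    simpa using shiftedFactorial_one_add_nat_ne_zero (p * n) a
  have n3 : ∏ l ∈ Finset.range n, shiftedFactorial (1 + p * l) (m + m') ≠ 0 := by
    refine Finset.prod_ne_zero_iff.2 fun l _ => ?_
    simpa using shiftedFactorial_one_add_nat_ne_zero (p * l) (m + m')
  push_cast
  field_simp

/-- The quotient of the summand at `p n + a` by the summand at `n`. -/
noncomputable def termRatio (p : ℕ) (r₁ r₂ : ℚ) (m₁ m₁' m₂ m₂' n a : ℕ) : ℚ :=
  ((∏ l ∈ Finset.range n, blockFactor r₁ (p * l) m₁ m₁') * shiftTerm r₁ (p * n) a) *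
    ((∏ l ∈ Finset.range n, blockFactor r₂ (p * l) m₂ m₂') * shiftTerm r₂ (p * n) a)

section
variable {p : ℕ}

lemma isPUnit_punctured {m m' : ℕ} (hp : p.Prime) (hm : p = m + 1 + m') {r' x : ℚ}
    (hr' : r' ∈ pIntegral p) (hx : x ∈ pIntegral p) :
    IsPUnit p (punctured (p * r' - m + p * x) m m') := by
  refine (isPUnit_shiftedFactorial fun i hi => ?_).mul (isPUnit_shiftedFactorial fun i hi => ?_)
  · have := isPUnit_int_add (i := (i : ℤ) - m) (isCoprime_of_abs_lt hp (by omega)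
      (by rw [abs_lt]; omega)) hp (add_mem hr' hx)
    push_cast at this
    convert this using 1
    ring
  · have := isPUnit_int_add (i := (i : ℤ) + 1) (isCoprime_of_abs_lt hp (by omega)
      (by rw [abs_lt]; omega)) hp (add_mem hr' hx)
    push_cast at this
    convert this using 1
    ring

lemma isPUnit_shiftedFactorial_one_add (hp : p.Prime) {x : ℚ} (hx : x ∈ pIntegral p) {k : ℕ}
    (hk : k < p) : IsPUnit p (shiftedFactorial (1 + p * x) k) := by
  refine isPUnit_shiftedFactorial fun i hi => ?_
  have := isPUnit_int_add (i := (i : ℤ) + 1) (isCoprime_of_abs_lt hp (by omega)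
    (by rw [abs_lt]; omega)) hp hx
  push_cast at this
  convert this using 1
  ring

lemma isPUnit_blockFactor {m m' : ℕ} (hp : p.Prime) (hm : p = m + 1 + m') {r r' x : ℚ}
    (hr : p * r' = r + m) (hr' : r' ∈ pIntegral p) (hx : x ∈ pIntegral p) :
    IsPUnit p (blockFactor r (p * x) m m') := by
  unfold blockFactor
  rw [div_eq_mul_inv]
  refine (IsPUnit.mul ?_ ?_).mul
    ((isPUnit_shiftedFactorial_one_add hp hx (by omega)).pow 2).inv
  · have := isPUnit_punctured hp hm hr' hx
    rwa [show p * r' - m = r by rw [hr]; ring] at this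
  · have := isPUnit_punctured (m := m') (m' := m) hp (by omega)
      (sub_mem (one_mem _) hr') hx
    rwa [show p * (1 - r') - m' = 1 - r by rw [mul_sub, hr]; rw [hm]; push_cast; ring] at this

lemma shiftTerm_mem (hp : p.Prime) {r x : ℚ} (hr : r ∈ pIntegral p) (hx : x ∈ pIntegral p)
    {a : ℕ} (ha : a < p) : shiftTerm r (p * x) a ∈ pIntegral p := by
  unfold shiftTerm
  rw [div_eq_mul_inv]
  have hpx : p * x ∈ pIntegral p := mul_mem (natCast_mem_pIntegral p) hx
  exact mul_mem (mul_mem (shiftedFactorial_mem (add_mem hr hpx) a)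
    (shiftedFactorial_mem (add_mem (sub_mem (one_mem _) hr) hpx) a))
    ((isPUnit_shiftedFactorial_one_add hp hx ha).pow 2).2.2

end

/-! ### From congruences between blocks to congruences between truncated sums -/

lemma sum_range_mul_eq (f : ℕ → ℚ) (p N : ℕ) :
    ∑ k ∈ Finset.range (p * N), f k =
      ∑ n ∈ Finset.range N, ∑ a ∈ Finset.range p, f (p * n + a) := by
  induction N with
  | zero => simp
  | succ N ih => rw [mul_add, mul_one, Finset.sum_range_add, ih, Finset.sum_range_succ]

/-- A prime `p` and parameters for which Dwork's operation `r ↦ r'` preserves the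
hypergeometric term. -/
structure FrobeniusData (p : ℕ) (r₁ r₂ : ℚ) where
  /-- the image of `r₁` -/
  s₁ : ℚ
  /-- the image of `r₂` -/
  s₂ : ℚ
  /-- the representative of `-r₁` in `[0, p)` -/
  m₁ : ℕ
  /-- `p - 1 - m₁` -/
  m₁' : ℕ
  /-- the representative of `-r₂` in `[0, p)` -/
  m₂ : ℕ
  /-- `p - 1 - m₂` -/
  m₂' : ℕ
  prime : p.Prime
  mem₁ : s₁ ∈ pIntegral p
  mem₂ : s₂ ∈ pIntegral p
  eq₁ : p * s₁ = r₁ + m₁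
  eq₂ : p * s₂ = r₂ + m₂
  hm₁ : p = m₁ + 1 + m₁'
  hm₂ : p = m₂ + 1 + m₂'
  hTerm_eq : ∀ n, hTerm s₁ s₂ n = hTerm r₁ r₂ n

namespace FrobeniusData
variable {p : ℕ} {r₁ r₂ : ℚ}

/-- The quotient of the summand at `p n + a` by the summand at `n`. -/
noncomputable def ratio (D : FrobeniusData p r₁ r₂) (n a : ℕ) : ℚ :=
  termRatio p r₁ r₂ D.m₁ D.m₁' D.m₂ D.m₂' n a

lemma hTerm_add (D : FrobeniusData p r₁ r₂) (n a : ℕ) :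
    hTerm r₁ r₂ (p * n + a) = hTerm r₁ r₂ n * D.ratio n a := by
  rw [← D.hTerm_eq n]
  unfold ratio termRatio hTerm
  rw [pairTerm_add_mul D.prime D.hm₁ D.eq₁, pairTerm_add_mul D.prime D.hm₂ D.eq₂]
  ring

lemma mem_r₁ (D : FrobeniusData p r₁ r₂) : r₁ ∈ pIntegral p := by
  rw [show r₁ = p * D.s₁ - D.m₁ by rw [D.eq₁]; ring]
  exact sub_mem (mul_mem (natCast_mem_pIntegral p) D.mem₁) (natCast_mem_pIntegral _)

lemma mem_r₂ (D : FrobeniusData p r₁ r₂) : r₂ ∈ pIntegral p := by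
  rw [show r₂ = p * D.s₂ - D.m₂ by rw [D.eq₂]; ring]
  exact sub_mem (mul_mem (natCast_mem_pIntegral p) D.mem₂) (natCast_mem_pIntegral _)

lemma ratio_mem (D : FrobeniusData p r₁ r₂) (n : ℕ) {a : ℕ} (ha : a < p) :
    D.ratio n a ∈ pIntegral p :=
  mul_mem
    (mul_mem (prod_mem fun l _ =>
      (isPUnit_blockFactor D.prime D.hm₁ D.eq₁ D.mem₁ (natCast_mem_pIntegral l)).2.1)
      (shiftTerm_mem D.prime D.mem_r₁ (natCast_mem_pIntegral n) ha))
    (mul_mem (prod_mem fun l _ =>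
      (isPUnit_blockFactor D.prime D.hm₂ D.eq₂ D.mem₂ (natCast_mem_pIntegral l)).2.1)
      (shiftTerm_mem D.prime D.mem_r₂ (natCast_mem_pIntegral n) ha))

lemma hTerm_mem (D : FrobeniusData p r₁ r₂) (k : ℕ) : hTerm r₁ r₂ k ∈ pIntegral p := by
  induction k using Nat.strong_induction_on with
  | _ k ih =>
    rcases Nat.eq_zero_or_pos k with rfl | hk
    · rw [hTerm_zero]; exact one_mem _
    · rw [← Nat.div_add_mod k p, D.hTerm_add]
      exact mul_mem (ih _ (Nat.div_lt_self hk D.prime.one_lt))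
        (D.ratio_mem _ (Nat.mod_lt _ D.prime.pos))

lemma truncH_mem (D : FrobeniusData p r₁ r₂) (N : ℕ) : truncH r₁ r₂ N ∈ pIntegral p := by
  rw [truncH_eq_sum]
  exact sum_mem fun k _ => D.hTerm_mem k

lemma truncH_mul (D : FrobeniusData p r₁ r₂) (N : ℕ) : truncH r₁ r₂ (p * N) =
    ∑ n ∈ Finset.range N, hTerm r₁ r₂ n * ∑ a ∈ Finset.range p, D.ratio n a := by
  rw [truncH_eq_sum, sum_range_mul_eq]
  simp only [D.hTerm_add, Finset.mul_sum]

/-- If the sum over each block is, up to the summand in front of it, independent of the block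
modulo `p³`, then `H(p^{s+1}) ≡ H(p) H(p^s)` modulo `p³`, and the theorem follows. -/
theorem ratCongr_of_block (D : FrobeniusData p r₁ r₂)
    (h : ∀ n, PCongr p 3 (hTerm r₁ r₂ n * ∑ a ∈ Finset.range p, D.ratio n a)
      (hTerm r₁ r₂ n * ∑ a ∈ Finset.range p, D.ratio 0 a))
    (hH : ¬ RatCongr p (truncH r₁ r₂ p) 0) (s : ℕ) (hs : 1 ≤ s) :
    RatCongr (p ^ 3)
      (truncH r₁ r₂ (p ^ (s + 1)) / truncH r₁ r₂ (p ^ s))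
      (truncH r₁ r₂ (p ^ s) / truncH r₁ r₂ (p ^ (s - 1))) := by
  have hp := D.prime
  have hHp : truncH r₁ r₂ p = ∑ a ∈ Finset.range p, D.ratio 0 a := by
    have := D.truncH_mul 1
    simpa [hTerm_zero] using this
  have hunit : IsPUnit p (truncH r₁ r₂ p) := by
    refine (pIntegral_isPUnit_or hp (D.truncH_mem p)).resolve_right fun h1 => hH ?_
    simpa using (ratCongr_pow_iff one_ne_zero _ _).2 h1
  have step : ∀ t, PCongr p 3 (truncH r₁ r₂ (p ^ (t + 1)))
      (truncH r₁ r₂ (p ^ t) * truncH r₁ r₂ p) := by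
    intro t
    rw [pow_succ', D.truncH_mul, truncH_eq_sum r₁ r₂ (p ^ t), hHp, Finset.sum_mul]
    exact PCongr.sum fun n _ => h n
  have units : ∀ t, IsPUnit p (truncH r₁ r₂ (p ^ t)) := by
    intro t
    induction t with
    | zero => simpa [truncH_eq_sum, hTerm_zero] using isPUnit_one
    | succ t ih => exact (step t).isPUnit hp three_ne_zero (ih.mul hunit)
  have quot : ∀ t, PCongr p 3 (truncH r₁ r₂ (p ^ (t + 1)) / truncH r₁ r₂ (p ^ t))
      (truncH r₁ r₂ p) := by
    intro t
    refine PCongr.of_mul_left (units t) ?_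
    rw [mul_div_cancel₀ _ (units t).1]
    exact step t
  rw [ratCongr_pow_iff three_ne_zero]
  obtain ⟨t, rfl⟩ : ∃ t, s = t + 1 := ⟨s - 1, by omega⟩
  exact (quot (t + 1)).trans (quot t).symm

end FrobeniusData

/-! ### The product of the factors prime to `p` in closed form -/

section
open Polynomial

/-- The coefficients of `X` and `X²` in `∏_{0 < j < p} (X + j) ≡ X^{p - 1} - 1` vanish modulo
`p ≥ 5`. -/
lemma prime_dvd_coeff_prod {p : ℕ} (hp : p.Prime) (h5 : 5 ≤ p) {k : ℕ} (hk : k = 1 ∨ k = 2) :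
    (p : ℤ) ∣ (∏ j ∈ Finset.range (p - 1), (X + C ((j : ℤ) + 1))).coeff k := by
  have : Fact p.Prime := ⟨hp⟩
  have key : (∏ j ∈ Finset.range p, (X + C (j : ZMod p))) = (X ^ p - X : (ZMod p)[X]) := by
    have hmon : (∏ j ∈ Finset.range p, (X + C (j : ZMod p))).Monic :=
      monic_prod_of_monic _ _ fun j _ => monic_X_add_C _
    have hdeg : (∏ j ∈ Finset.range p, (X + C (j : ZMod p))).degree = (p : WithBot ℕ) := by
      rw [degree_prod]
      simp only [degree_X_add_C, Finset.sum_const, Finset.card_range, nsmul_eq_mul, mul_one]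
    have hdeg' : (X ^ p - X : (ZMod p)[X]).degree = (p : WithBot ℕ) := by
      rw [degree_sub_eq_left_of_degree_lt] <;> rw [degree_X_pow]
      rw [degree_X]
      exact_mod_cast hp.one_lt
    have hmon' : (X ^ p - X : (ZMod p)[X]).Monic :=
      monic_X_pow_sub (by rw [degree_X]; exact_mod_cast hp.one_lt)
    refine eq_of_degree_sub_lt_of_eval_finset_eq Finset.univ ?_ fun a _ => ?_
    · refine (degree_sub_lt_left (by rw [hdeg, hdeg']) hmon.ne_zero ?_).trans_eq ?_
      · rw [hmon.leadingCoeff, hmon'.leadingCoeff]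
      · rw [hdeg, Finset.card_univ, ZMod.card]
    · rw [eval_sub, eval_pow, eval_X, ZMod.pow_card, sub_self, eval_prod]
      refine Finset.prod_eq_zero (i := (-a).val) (Finset.mem_range.2 (ZMod.val_lt _)) ?_
      simp
  rw [← ZMod.intCast_zmod_eq_zero_iff_dvd, ← eq_intCast (Int.castRingHom (ZMod p)), ← coeff_map,
    Polynomial.map_prod]
  have h1 : ∏ j ∈ Finset.range p, (X + C (j : ZMod p)) =
      (∏ j ∈ Finset.range (p - 1), Polynomial.map (Int.castRingHom (ZMod p))
        (X + C ((j : ℤ) + 1))) * X := by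
    obtain ⟨q, rfl⟩ : ∃ q, p = q + 1 := ⟨p - 1, by have := hp.pos; omega⟩
    rw [Finset.prod_range_succ', Nat.add_sub_cancel]
    simp
  rw [← coeff_mul_X, ← h1, key, coeff_sub, coeff_X_pow, coeff_X]
  rcases hk with rfl | rfl
  · rw [if_neg (by omega), if_neg (by omega), sub_zero]
  · rw [if_neg (by omega), if_neg (by omega), sub_zero]

end

section
variable {p : ℕ}

/-- Wolstenholme's congruence for the shifted product `(1 + y)_{p - 1}` at `y = p z`: the
coefficients of `y` and `y²` are divisible by `p`, so that no quadratic term is left modulo `p³`. -/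
lemma shiftedFactorial_one_add_pcongr (hp : p.Prime) (h5 : 5 ≤ p) :
    ∃ c₀ c₁ : ℚ, c₀ ∈ pIntegral p ∧ c₁ ∈ pIntegral p ∧ ∀ z ∈ pIntegral p,
      PCongr p 3 (shiftedFactorial (1 + p * z) (p - 1)) (c₀ + c₁ * (p ^ 2 * z)) := by
  obtain ⟨c, hc⟩ := prime_dvd_coeff_prod hp h5 (Or.inl rfl)
  obtain ⟨d, hd⟩ := prime_dvd_coeff_prod hp h5 (Or.inr rfl)
  set q := ∏ j ∈ Finset.range (p - 1), (Polynomial.X + Polynomial.C ((j : ℤ) + 1)) with hq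
  refine ⟨q.coeff 0, c, intCast_mem_pIntegral _, intCast_mem_pIntegral _, fun z hz => ?_⟩
  have hev : shiftedFactorial (1 + p * z) (p - 1) = Polynomial.aeval (p * z) q := by
    rw [shiftedFactorial_eq_prod, hq, map_prod]
    refine Finset.prod_congr rfl fun j _ => ?_
    simp
    ring
  set w := q.divX.divX.divX with hw
  have hexp : q = (((w * Polynomial.X + Polynomial.C (q.coeff 2)) * Polynomial.X
      + Polynomial.C (q.coeff 1)) * Polynomial.X + Polynomial.C (q.coeff 0)) := by
    have e1 := q.divX_mul_X_add
    have e2 := q.divX.divX_mul_X_add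
    have e3 := q.divX.divX.divX_mul_X_add
    simp only [Polynomial.coeff_divX, zero_add] at e2 e3
    rw [hw, e3, e2, e1]
  have hwm : Polynomial.aeval (p * z) w ∈ pIntegral p := by
    rw [Polynomial.aeval_eq_sum_range]
    refine sum_mem fun i _ => ?_
    rw [zsmul_eq_mul]
    exact mul_mem (intCast_mem_pIntegral _)
      (pow_mem (mul_mem (natCast_mem_pIntegral p) hz) _)
  refine ⟨Polynomial.aeval (p * z) w * z ^ 3 + d * z ^ 2, add_mem (mul_mem hwm (pow_mem hz _))
    (mul_mem (intCast_mem_pIntegral _) (pow_mem hz _)), ?_⟩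
  have h2 : Polynomial.aeval (p * z) q = ((Polynomial.aeval (p * z) w * (p * z) + q.coeff 2) *
      (p * z) + q.coeff 1) * (p * z) + q.coeff 0 := by
    conv_lhs => rw [hexp]
    simp
  rw [hev, h2, hc, hd]
  push_cast
  ring

/-- The defect in the recurrence `blockFactor_mul` is trivial modulo `p³`: modulo `p³` the function
`(1 + y)_{p - 1}` is affine in `y ∈ p ℤ_(p)` with slope divisible by `p`. -/
lemma shiftedFactorial_one_add_mul_pcongr (hp : p.Prime) (h5 : 5 ≤ p) {s x : ℚ}
    (hs : s ∈ pIntegral p) (hx : x ∈ pIntegral p) :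
    PCongr p 3
      (shiftedFactorial (1 + p * (x + s)) (p - 1) * shiftedFactorial (1 + p * (x - s)) (p - 1))
      (shiftedFactorial (1 + p * x) (p - 1) ^ 2) := by
  obtain ⟨c₀, c₁, h₀, h₁, h⟩ := shiftedFactorial_one_add_pcongr hp h5
  have hp' := natCast_mem_pIntegral (p := p) p
  have hmem : ∀ z ∈ pIntegral p, c₀ + c₁ * (p ^ 2 * z) ∈ pIntegral p := fun z hz =>
    add_mem h₀ (mul_mem h₁ (mul_mem (pow_mem hp' 2) hz))
  have e1 := (h _ (add_mem hx hs)).mul ((h _ (sub_mem hx hs)).mem (hmem _ (sub_mem hx hs)))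
    (hmem _ (add_mem hx hs)) (h _ (sub_mem hx hs))
  have e2 := (h _ hx).mul ((h _ hx).mem (hmem _ hx)) (hmem _ hx) (h _ hx)
  rw [sq]
  refine e1.trans (PCongr.trans ⟨-(c₁ ^ 2 * p * s ^ 2), ?_, by ring⟩ e2.symm)
  exact neg_mem (mul_mem (mul_mem (pow_mem h₁ 2) hp') (pow_mem hs 2))

/-- An exact functional equation: `(r - x)_m / (r + x)_m` solves the first order recurrence whose
coefficient is the block factor, up to a defect that is trivial modulo `p³`. -/
lemma blockFactor_mul {m m' : ℕ} (hm : p = m + 1 + m') {r x : ℚ}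
    (h0 : shiftedFactorial (r + x) m ≠ 0) (h1 : shiftedFactorial (r + (x + p)) m ≠ 0) :
    shiftedFactorial (r - x) m / shiftedFactorial (r + x) m * blockFactor r x m m' =
      shiftedFactorial (r - (x + p)) m / shiftedFactorial (r + (x + p)) m *
        (shiftedFactorial (1 + (x + (r + m))) (p - 1) *
          shiftedFactorial (1 + (x - (r + m))) (p - 1) /
          shiftedFactorial (1 + x) (p - 1) ^ 2) := by
  have hp1 : p - 1 = m + m' := by omega
  have hpQ : (p : ℚ) = m + 1 + m' := by rw [hm]; push_cast; ring
  unfold blockFactor punctured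
  rw [hp1]
  have e1 : shiftedFactorial (1 + (x + (r + m))) (m + m') =
      shiftedFactorial (r + x + m + 1) m' * shiftedFactorial (r + (x + p)) m := by
    rw [add_comm m m', shiftedFactorial_add, hpQ]
    ring_nf
  have e2 : shiftedFactorial (1 + (x - (r + m))) (m + m') =
      shiftedFactorial (1 - m - (r - x)) m * shiftedFactorial (1 - r + x) m' := by
    rw [shiftedFactorial_add]
    ring_nf
  have e3 : shiftedFactorial (1 - r + x + m' + 1) m =
      (-1) ^ m * shiftedFactorial (r - (x + p)) m := by
    rw [← shiftedFactorial_reflect, hpQ]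
    ring_nf
  rw [e1, e2, e3, shiftedFactorial_reflect]
  field_simp

lemma isPUnit_shiftedFactorial_add (hp : p.Prime) {m : ℕ} (hm : m < p) {e x : ℚ}
    (he : e ∈ pIntegral p) (hx : x ∈ pIntegral p) :
    IsPUnit p (shiftedFactorial (p * e - m + p * x) m) := by
  refine isPUnit_shiftedFactorial fun i hi => ?_
  have := isPUnit_int_add (i := (i : ℤ) - m) (isCoprime_of_abs_lt hp (by omega)
    (by rw [abs_lt]; omega)) hp (add_mem he hx)
  push_cast at this
  convert this using 1
  ring

/-- The product of the block factors is a ratio of shifted factorials modulo `p³`; in particular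
it is an analytic function of `p n`. -/
lemma prod_blockFactor_pcongr {m m' : ℕ} (hp : p.Prime) (h5 : 5 ≤ p) (hm : p = m + 1 + m') {e : ℚ}
    (he : e ∈ pIntegral p) (n : ℕ) :
    PCongr p 3 (∏ l ∈ Finset.range n, blockFactor (p * e - m) (p * l) m m')
      (shiftedFactorial (p * e - m - p * n) m / shiftedFactorial (p * e - m + p * n) m) := by
  have unit : ∀ n : ℕ, IsPUnit p (shiftedFactorial (p * e - m + p * n) m) := fun n =>
    isPUnit_shiftedFactorial_add hp (by omega) he (natCast_mem_pIntegral n)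
  have unit' : ∀ n : ℕ, IsPUnit p (shiftedFactorial (p * e - m - p * n) m) := fun n => by
    have := isPUnit_shiftedFactorial_add hp (by omega : m < p) he
      (neg_mem (natCast_mem_pIntegral (p := p) n))
    rwa [mul_neg, ← sub_eq_add_neg] at this
  induction n with
  | zero =>
    have h := (unit 0).1
    refine .of_eq ?_
    simp only [Nat.cast_zero, mul_zero, add_zero, sub_zero] at h ⊢
    rw [Finset.prod_range_zero, div_self h]
  | succ n ih =>
    have hb := isPUnit_blockFactor hp hm (r := p * e - m) (by ring) he
      (natCast_mem_pIntegral (p := p) n)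
    have hx := natCast_mem_pIntegral (p := p) n
    have hnext := unit (n + 1)
    have hnext' := unit' (n + 1)
    push_cast at hnext hnext'
    rw [mul_add, mul_one] at hnext hnext'
    have hg := shiftedFactorial_one_add_mul_pcongr hp h5 he hx
    have hu := (isPUnit_shiftedFactorial_one_add hp hx (k := p - 1)
      (by have := hp.pos; omega)).pow 2
    have hdefect := hg.mul_left hu.2.2
    rw [inv_mul_cancel₀ hu.1] at hdefect
    have h1 := ih.mul_left hb.2.1
    rw [mul_comm _ (∏ l ∈ Finset.range n, _), ← Finset.prod_range_succ,
      mul_comm (blockFactor _ _ _ _), blockFactor_mul hm (unit n).1 hnext.1] at h1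
    push_cast
    rw [mul_add, mul_one]
    refine h1.trans ?_
    have h2 := hdefect.mul_left (hnext'.mul hnext.inv).2.1
    rw [mul_one, ← div_eq_mul_inv] at h2
    convert h2 using 2
    rw [inv_mul_eq_div]
    congr 3 <;> ring_nf

end

/-! ### Integral parameters: partial fractions -/

/-- The value at `x = p n` of the summand in closed form modulo `p³`. -/
noncomputable def analyticTerm (r x : ℚ) (m a : ℕ) : ℚ :=
  shiftedFactorial (r - x) m / shiftedFactorial (r + x) m * shiftTerm r x a

section
variable {p : ℕ}

lemma pcongr_one_zero_of_dvd {k : ℤ} (h : (p : ℤ) ∣ k) : PCongr p 1 k 0 := by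
  obtain ⟨c, rfl⟩ := h
  exact ⟨c, intCast_mem_pIntegral c, by push_cast; ring⟩

/-- `∑ 1 / b^k ≡ 0` modulo `p`, where `b` runs through the nonzero residues and `0 < k < p - 1`. -/
lemma sum_inv_pow_pcongr (hp : p.Prime) {k : ℕ} (hk : 0 < k) (hkp : k < p - 1) {i : ℕ} (hi : i < p)
    {x : ℚ} (hx : x ∈ pIntegral p) :
    PCongr p 1 (∑ a ∈ (Finset.range p).erase i, ((p * x + a - i)⁻¹) ^ k) 0 := by
  have : Fact p.Prime := ⟨hp⟩
  have hterm : ∀ a ∈ (Finset.range p).erase i,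
      PCongr p 1 (((p * x + a - i)⁻¹) ^ k) ((((a : ℤ) - i) ^ (p - 1 - k) : ℤ) : ℚ) := by
    intro a ha
    rw [Finset.mem_erase, Finset.mem_range] at ha
    have hcop : IsCoprime ((a : ℤ) - i) (p : ℤ) :=
      isCoprime_of_abs_lt hp (by omega) (by rw [abs_lt]; omega)
    have hu : IsPUnit p (p * x + a - i) := by
      have := isPUnit_int_add hcop hp hx
      push_cast at this
      convert this using 1
      ring
    have hb := isPUnit_int hcop hp
    have h1 : PCongr p 1 (p * x + a - i) (((a : ℤ) - i : ℤ) : ℚ) :=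
      ⟨x, hx, by push_cast; ring⟩
    have h2 : PCongr p 1 ((p * x + a - i) ^ k) ((((a : ℤ) - i : ℤ) : ℚ) ^ k) := by
      clear hk hkp
      induction k with
      | zero => exact .of_eq (by simp)
      | succ k ih => rw [pow_succ, pow_succ]; exact ih.mul hu.2.1 (hb.pow k).2.1 h1
    rw [inv_pow]
    refine (PCongr.inv (hu.pow k) (hb.pow k) h2).trans ?_
    refine PCongr.of_mul_left (hb.pow k) ?_
    rw [mul_inv_cancel₀ (hb.pow k).1]
    push_cast
    rw [← pow_add, Nat.add_sub_cancel' hkp.le, ← pcongr_sub_zero_iff]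
    have hF := (Int.ModEq.pow_card_sub_one_eq_one hp hcop).dvd
    have := pcongr_one_zero_of_dvd hF
    push_cast at this
    exact this
  refine (PCongr.sum hterm).trans ?_
  rw [← Int.cast_sum]
  refine pcongr_one_zero_of_dvd ?_
  rw [← ZMod.intCast_zmod_eq_zero_iff_dvd, Int.cast_sum, Finset.sum_erase]
  · rw [← FiniteField.sum_pow_lt_card_sub_one (K := ZMod p) (p - 1 - k) (by rw [ZMod.card]; omega)]
    refine Finset.sum_bij' (fun a _ => (a : ZMod p) - i) (fun z _ => (z + i).val)
      (fun _ _ => Finset.mem_univ _) (fun z _ => Finset.mem_range.2 (ZMod.val_lt _)) ?_ ?_ ?_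
    · intro a ha
      rw [sub_add_cancel, ZMod.val_natCast, Nat.mod_eq_of_lt (Finset.mem_range.1 ha)]
    · intro z _
      simp
    · intro a _
      push_cast
      rfl
  · rw [sub_self, zero_pow (by omega), Int.cast_zero]

/-- Orthogonality of the simple fractions `x / (x + a - i)` under summation over a full system of
residues `a`. -/
lemma sum_simple_fractions_pcongr (hp : p.Prime) (h5 : 5 ≤ p) {i j : ℕ} (hi : i < p) (hj : j < p)
    {n : ℕ} (hn : n ≠ 0) :
    PCongr p 3 (∑ a ∈ Finset.range p,
      ((p * n : ℚ) * (p * n + a - i : ℚ)⁻¹) * ((p * n : ℚ) * (p * n + a - j : ℚ)⁻¹))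
      (if i = j then 1 else 0) := by
  have hn' := natCast_mem_pIntegral (p := p) n
  have hx0 : (p * n : ℚ) ≠ 0 := by
    have := hp.ne_zero
    positivity
  have hsq : PCongr p 2 ((p * n : ℚ) ^ 2) 0 := ⟨n ^ 2, pow_mem hn' 2, by ring⟩
  split_ifs with hij
  · subst hij
    rw [← Finset.add_sum_erase _ _ (Finset.mem_range.2 hi), add_sub_cancel_right,
      mul_inv_cancel₀ hx0, mul_one]
    have h1 := hsq.mul_of_zero (sum_inv_pow_pcongr hp two_pos (by omega) hi hn')
    rw [Finset.mul_sum] at h1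
    have h2 := (PCongr.refl 3 1).add h1
    rw [add_zero] at h2
    refine (PCongr.of_eq (congrArg (1 + ·) ?_)).trans h2
    refine Finset.sum_congr rfl fun a _ => ?_
    ring
  · have single : ∀ i < p, ∑ a ∈ Finset.range p, (p * n + a - i : ℚ)⁻¹ =
        (p * n : ℚ)⁻¹ + ∑ a ∈ (Finset.range p).erase i, ((p * n + a - i : ℚ)⁻¹) ^ 1 := by
      intro i hi
      rw [← Finset.add_sum_erase _ _ (Finset.mem_range.2 hi), add_sub_cancel_right]
      simp
    have hu : IsPUnit p (((i : ℤ) - j : ℤ) : ℚ) :=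
      isPUnit_int (isCoprime_of_abs_lt hp (by omega) (by rw [abs_lt]; omega)) hp
    have hdiff : PCongr p 1 (∑ a ∈ Finset.range p, (p * n + a - i : ℚ)⁻¹ -
        ∑ a ∈ Finset.range p, (p * n + a - j : ℚ)⁻¹) 0 := by
      rw [single i hi, single j hj, add_sub_add_left_eq_sub, pcongr_sub_zero_iff]
      exact (sum_inv_pow_pcongr hp one_pos (by omega) hi hn').trans
        (sum_inv_pow_pcongr hp one_pos (by omega) hj hn').symm
    refine PCongr.of_mul_left hu ?_
    rw [mul_zero]
    have h1 := hsq.mul_of_zero hdiff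
    convert h1 using 1
    rw [← Finset.sum_sub_distrib, Finset.mul_sum, Finset.mul_sum]
    refine Finset.sum_congr rfl fun a _ => ?_
    have ne : ∀ i < p, (p * n + a - i : ℚ) ≠ 0 := by
      intro i hi h
      have h' : p * n + a = i := by
        have : (p * n + a : ℚ) = i := by linarith
        exact_mod_cast this
      have : p * 1 ≤ p * n := Nat.mul_le_mul_left p (Nat.one_le_iff_ne_zero.2 hn)
      omega
    have ni := ne i hi
    have nj := ne j hj
    push_cast
    field_simp
    ring

/-- For `r = -m` the summand is a rational function of `t = x + a`, up to a factor `x`. -/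
lemma analyticTerm_neg_eq {x : ℚ} {m a : ℕ}
    (h0 : shiftedFactorial (-m + x) (m + 1 + a) ≠ 0) (h1 : shiftedFactorial (1 + x) (m + a) ≠ 0) :
    analyticTerm (-m) x m a = (-1) ^ m * (x * (shiftedFactorial (x + a + 1) m /
      shiftedFactorial (x + a - m) (m + 1))) := by
  have e1 : shiftedFactorial (-m - x) m = (-1) ^ m * shiftedFactorial (1 + x) m := by
    rw [← shiftedFactorial_reflect]
    ring_nf
  have e2 : shiftedFactorial (1 + x) (m + a) =
      shiftedFactorial (1 + x) m * shiftedFactorial (1 - -m + x) a := by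
    rw [shiftedFactorial_add]
    ring_nf
  have e3 : shiftedFactorial (1 + x) (m + a) =
      shiftedFactorial (1 + x) a * shiftedFactorial (x + a + 1) m := by
    rw [add_comm m a, shiftedFactorial_add]
    ring_nf
  have e4 : shiftedFactorial (-m + x) (m + 1 + a) =
      shiftedFactorial (-m + x) m * x * shiftedFactorial (1 + x) a := by
    rw [shiftedFactorial_add, shiftedFactorial_succ]
    push_cast
    ring_nf
  have e5 : shiftedFactorial (-m + x) (m + 1 + a) =
      shiftedFactorial (-m + x) a * shiftedFactorial (x + a - m) (m + 1) := by
    rw [add_comm (m + 1) a, shiftedFactorial_add]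
    ring_nf
  have n1 : shiftedFactorial (-m + x) m ≠ 0 := by
    intro h; rw [e4, h, zero_mul, zero_mul] at h0; exact h0 rfl
  have n2 : shiftedFactorial (1 + x) a ≠ 0 := by
    intro h; rw [e3, h, zero_mul] at h1; exact h1 rfl
  have n3 : shiftedFactorial (x + a - m) (m + 1) ≠ 0 := by
    intro h; rw [e5, h, mul_zero] at h0; exact h0 rfl
  have e6 := e2.symm.trans e3
  have e7 := e4.symm.trans e5
  unfold analyticTerm shiftTerm
  rw [e1, div_mul_div_comm, ← mul_div_assoc x, ← mul_div_assoc ((-1) ^ m), div_eq_div_iff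
    (mul_ne_zero n1 (pow_ne_zero 2 n2)) n3]
  linear_combination (-1) ^ m * (shiftedFactorial (-m + x) a * shiftedFactorial (x + a - m) (m + 1))
    * e6 - (-1) ^ m * shiftedFactorial (1 + x) a * shiftedFactorial (x + a + 1) m * e7

/-- The partial fraction decomposition of `(t + 1)_m / (t - m)_{m + 1}` has `p`-integral
coefficients. -/
lemma exists_partial_fractions (hp : p.Prime) {m : ℕ} (hm : m < p) :
    ∃ c : ℕ → ℚ, (∀ i, c i ∈ pIntegral p) ∧ ∀ t : ℚ, (∀ i ∈ Finset.range (m + 1), t ≠ i) →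
      shiftedFactorial (t + 1) m / shiftedFactorial (t - m) (m + 1) =
        ∑ i ∈ Finset.range (m + 1), c i * (t - i)⁻¹ := by
  set v : ℕ → ℚ := fun i => i with hv
  set N : Polynomial ℚ :=
    ∏ j ∈ Finset.range m, (Polynomial.X + Polynomial.C ((j : ℚ) + 1)) with hN
  have hNeval : ∀ t : ℚ, N.eval t = shiftedFactorial (t + 1) m := by
    intro t
    rw [shiftedFactorial_eq_prod, hN, Polynomial.eval_prod]
    refine Finset.prod_congr rfl fun j _ => ?_
    simp
    ring
  have hdeg : N.degree < (Finset.range (m + 1)).card := by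
    rw [hN, Polynomial.degree_prod, Finset.card_range]
    simp only [Polynomial.degree_X_add_C, Finset.sum_const, Finset.card_range, nsmul_eq_mul,
      mul_one]
    exact_mod_cast Nat.lt_succ_self m
  have hinj : Set.InjOn v (Finset.range (m + 1)) := fun i _ j _ h => by
    simpa [hv] using h
  have hint := Lagrange.eq_interpolate hinj hdeg
  refine ⟨fun i => if i < m + 1 then Lagrange.nodalWeight (Finset.range (m + 1)) v i *
    N.eval (v i) else 0, fun i => ?_, fun t ht => ?_⟩
  · dsimp only
    split_ifs with hi
    · refine mul_mem (prod_mem fun j hj => ?_) ?_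
      · rw [Finset.mem_erase, Finset.mem_range] at hj
        have := (isPUnit_int (i := (i : ℤ) - j) (isCoprime_of_abs_lt hp (by omega)
          (by rw [abs_lt]; omega)) hp).2.2
        push_cast at this
        exact this
      · rw [hNeval]
        exact shiftedFactorial_mem (add_mem (natCast_mem_pIntegral i) (one_mem _)) _
    · exact zero_mem _
  · have h1 : N.eval t = (Lagrange.nodal (Finset.range (m + 1)) v).eval t *
        ∑ i ∈ Finset.range (m + 1),
          Lagrange.nodalWeight (Finset.range (m + 1)) v i * (t - v i)⁻¹ * N.eval (v i) := by
      conv_lhs => rw [hint]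
      exact Lagrange.eval_interpolate_not_at_node _ ht
    have hnodal : (Lagrange.nodal (Finset.range (m + 1)) v).eval t =
        shiftedFactorial (t - m) (m + 1) := by
      rw [Lagrange.eval_nodal, shiftedFactorial_eq_prod, ← Finset.prod_range_reflect]
      refine Finset.prod_congr rfl fun j hj => ?_
      rw [Finset.mem_range] at hj
      rw [hv, Nat.add_sub_cancel]
      push_cast [Nat.cast_sub (Nat.lt_succ_iff.1 hj)]
      ring
    have hne : shiftedFactorial (t - m) (m + 1) ≠ 0 := by
      rw [← hnodal, Lagrange.eval_nodal, Finset.prod_ne_zero_iff]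
      exact fun i hi => sub_ne_zero.2 (ht i hi)
    rw [← hNeval, h1, hnodal, mul_div_cancel_left₀ _ hne]
    refine Finset.sum_congr rfl fun i hi => ?_
    dsimp only
    rw [if_pos (Finset.mem_range.1 hi)]
    ring

/-- For parameters `r₁ = -m₁` and `r₂ = -m₂` the sum over a block is constant modulo `p³`. The
partial fractions of the summand have a vanishing sum of residues, and sums of `1 / b` and
`1 / b²` over nonzero residues vanish modulo `p`. -/
lemma exists_sum_analyticTerm_neg_pcongr (hp : p.Prime) (h5 : 5 ≤ p) {m₁ m₂ : ℕ} (h₁ : m₁ < p)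
    (h₂ : m₂ < p) : ∃ K : ℚ, ∀ n : ℕ, n ≠ 0 → PCongr p 3
      (∑ a ∈ Finset.range p,
        analyticTerm (-m₁) (p * n) m₁ a * analyticTerm (-m₂) (p * n) m₂ a) K := by
  obtain ⟨c, hc, hcf⟩ := exists_partial_fractions hp h₁
  obtain ⟨d, hd, hdf⟩ := exists_partial_fractions hp h₂
  refine ⟨∑ i ∈ Finset.range (m₁ + 1), ∑ j ∈ Finset.range (m₂ + 1),
    (-1) ^ m₁ * (-1) ^ m₂ * (c i * d j) * (if i = j then 1 else 0), fun n hn => ?_⟩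
  have hpn : p * 1 ≤ p * n := Nat.mul_le_mul_left p (Nat.one_le_iff_ne_zero.2 hn)
  have main : ∀ m < p, ∀ a : ℕ, analyticTerm (-m) (p * n) m a = (-1) ^ m * ((p * n : ℚ) *
      (shiftedFactorial (p * n + a + 1) m / shiftedFactorial (p * n + a - m) (m + 1))) := by
    intro m hm a
    refine analyticTerm_neg_eq ?_ ?_
    · rw [show (-m + p * n : ℚ) = 1 + ((p * n - 1 - m : ℕ) : ℚ) by
        rw [Nat.sub_sub, Nat.cast_sub (by omega)]; push_cast; ring]
      exact shiftedFactorial_one_add_nat_ne_zero _ _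
    · have := shiftedFactorial_one_add_nat_ne_zero (p * n) (m + a)
      push_cast at this
      exact this
  have hne : ∀ m < p, ∀ a : ℕ, ∀ i ∈ Finset.range (m + 1), (p * n + a : ℚ) ≠ i := by
    intro m hm a i hi h
    rw [Finset.mem_range] at hi
    have h' : p * n + a = i := by exact_mod_cast h
    omega
  have expand : ∑ a ∈ Finset.range p,
      analyticTerm (-m₁) (p * n) m₁ a * analyticTerm (-m₂) (p * n) m₂ a =
      ∑ i ∈ Finset.range (m₁ + 1), ∑ j ∈ Finset.range (m₂ + 1),
        (-1) ^ m₁ * (-1) ^ m₂ * (c i * d j) * ∑ a ∈ Finset.range p,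
          ((p * n : ℚ) * (p * n + a - i : ℚ)⁻¹) * ((p * n : ℚ) * (p * n + a - j : ℚ)⁻¹) := by
    have : ∀ a ∈ Finset.range p,
        analyticTerm (-m₁) (p * n) m₁ a * analyticTerm (-m₂) (p * n) m₂ a =
        ∑ i ∈ Finset.range (m₁ + 1), ∑ j ∈ Finset.range (m₂ + 1),
        (-1) ^ m₁ * (-1) ^ m₂ * (c i * d j) *
          (((p * n : ℚ) * (p * n + a - i : ℚ)⁻¹) * ((p * n : ℚ) * (p * n + a - j : ℚ)⁻¹)) := by
      intro a _
      rw [main m₁ h₁, main m₂ h₂, hcf _ (hne m₁ h₁ a), hdf _ (hne m₂ h₂ a), Finset.mul_sum,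
        Finset.mul_sum, Finset.mul_sum, Finset.mul_sum, Finset.sum_mul_sum]
      refine Finset.sum_congr rfl fun i _ => Finset.sum_congr rfl fun j _ => ?_
      ring
    rw [Finset.sum_congr rfl this, Finset.sum_comm]
    refine Finset.sum_congr rfl fun i _ => ?_
    rw [Finset.sum_comm]
    refine Finset.sum_congr rfl fun j _ => ?_
    rw [Finset.mul_sum]
  rw [expand]
  refine PCongr.sum fun i hi => PCongr.sum fun j hj => PCongr.mul_left ?_ ?_
  · exact mul_mem (mul_mem (pow_mem (neg_mem (one_mem _)) _) (pow_mem (neg_mem (one_mem _)) _))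
      (mul_mem (hc i) (hd j))
  · rw [Finset.mem_range] at hi hj
    exact sum_simple_fractions_pcongr hp h5 (by omega) (by omega) hn

end

/-! ### Interpolation in the parameters -/

/-- Functions of `(e, d, x)` that are quadratic polynomials in `p e, p d, p x` modulo `p³`. -/
def IsQuadratic (p : ℕ) (f : pIntegral p → pIntegral p → pIntegral p → ℚ) : Prop :=
  ∃ c₀ c₁ c₂ c₃ c₁₁ c₂₂ c₃₃ c₁₂ c₁₃ c₂₃ : pIntegral p, ∀ e d x : pIntegral p, ∃ z : pIntegral p,
    f e d x = ((c₀ + p * (c₁ * e + c₂ * d + c₃ * x) +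
      p ^ 2 * (c₁₁ * e ^ 2 + c₂₂ * d ^ 2 + c₃₃ * x ^ 2 + c₁₂ * (e * d) + c₁₃ * (e * x) +
        c₂₃ * (d * x)) + p ^ 3 * z : pIntegral p) : ℚ)

section
variable {p : ℕ} {f g : pIntegral p → pIntegral p → pIntegral p → ℚ}

lemma isQuadratic_const (c : pIntegral p) : IsQuadratic p fun _ _ _ => (c : ℚ) :=
  ⟨c, 0, 0, 0, 0, 0, 0, 0, 0, 0, fun _ _ _ => ⟨0, by simp⟩⟩

lemma IsQuadratic.add (hf : IsQuadratic p f) (hg : IsQuadratic p g) :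
    IsQuadratic p fun e d x => f e d x + g e d x := by
  obtain ⟨a₀, a₁, a₂, a₃, a₁₁, a₂₂, a₃₃, a₁₂, a₁₃, a₂₃, ha⟩ := hf
  obtain ⟨b₀, b₁, b₂, b₃, b₁₁, b₂₂, b₃₃, b₁₂, b₁₃, b₂₃, hb⟩ := hg
  refine ⟨a₀ + b₀, a₁ + b₁, a₂ + b₂, a₃ + b₃, a₁₁ + b₁₁, a₂₂ + b₂₂, a₃₃ + b₃₃, a₁₂ + b₁₂,
    a₁₃ + b₁₃, a₂₃ + b₂₃, fun e d x => ?_⟩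
  obtain ⟨z, hz⟩ := ha e d x
  obtain ⟨w, hw⟩ := hb e d x
  refine ⟨z + w, ?_⟩
  dsimp only
  rw [hz, hw, ← Subring.coe_add]
  congr 1
  ring

lemma IsQuadratic.mul (hf : IsQuadratic p f) (hg : IsQuadratic p g) :
    IsQuadratic p fun e d x => f e d x * g e d x := by
  obtain ⟨a₀, a₁, a₂, a₃, a₁₁, a₂₂, a₃₃, a₁₂, a₁₃, a₂₃, ha⟩ := hf
  obtain ⟨b₀, b₁, b₂, b₃, b₁₁, b₂₂, b₃₃, b₁₂, b₁₃, b₂₃, hb⟩ := hg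
  refine ⟨a₀ * b₀, a₀ * b₁ + a₁ * b₀, a₀ * b₂ + a₂ * b₀, a₀ * b₃ + a₃ * b₀,
    a₀ * b₁₁ + a₁ * b₁ + a₁₁ * b₀, a₀ * b₂₂ + a₂ * b₂ + a₂₂ * b₀, a₀ * b₃₃ + a₃ * b₃ + a₃₃ * b₀,
    a₀ * b₁₂ + a₁ * b₂ + a₂ * b₁ + a₁₂ * b₀, a₀ * b₁₃ + a₁ * b₃ + a₃ * b₁ + a₁₃ * b₀,
    a₀ * b₂₃ + a₂ * b₃ + a₃ * b₂ + a₂₃ * b₀, fun e d x => ?_⟩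
  obtain ⟨z, hz⟩ := ha e d x
  obtain ⟨w, hw⟩ := hb e d x
  dsimp only
  rw [hz, hw, ← Subring.coe_mul]
  -- the homogeneous parts of degree one and two of the two factors
  obtain ⟨A₁, hA₁⟩ : ∃ A, A = a₁ * e + a₂ * d + a₃ * x := ⟨_, rfl⟩
  obtain ⟨B₁, hB₁⟩ : ∃ B, B = b₁ * e + b₂ * d + b₃ * x := ⟨_, rfl⟩
  obtain ⟨A₂, hA₂⟩ : ∃ A, A = a₁₁ * e ^ 2 + a₂₂ * d ^ 2 + a₃₃ * x ^ 2 + a₁₂ * (e * d) +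
    a₁₃ * (e * x) + a₂₃ * (d * x) := ⟨_, rfl⟩
  obtain ⟨B₂, hB₂⟩ : ∃ B, B = b₁₁ * e ^ 2 + b₂₂ * d ^ 2 + b₃₃ * x ^ 2 + b₁₂ * (e * d) +
    b₁₃ * (e * x) + b₂₃ * (d * x) := ⟨_, rfl⟩
  refine ⟨z * (b₀ + p * B₁ + p ^ 2 * B₂ + p ^ 3 * w) + w * (a₀ + p * A₁ + p ^ 2 * A₂) +
    (A₁ * B₂ + A₂ * B₁) + p * (A₂ * B₂), ?_⟩
  rw [← hA₁, ← hA₂, ← hB₁, ← hB₂]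
  congr 1
  linear_combination (p * a₀) * hB₁ + (p * b₀) * hA₁ + p ^ 2 * a₀ * hB₂ + p ^ 2 * b₀ * hA₂ +
    p ^ 2 * B₁ * hA₁ + p ^ 2 * (a₁ * e + a₂ * d + a₃ * x) * hB₁

lemma isQuadratic_sum {ι : Type*} (s : Finset ι)
    {F : ι → pIntegral p → pIntegral p → pIntegral p → ℚ} (h : ∀ i ∈ s, IsQuadratic p (F i)) :
    IsQuadratic p fun e d x => ∑ i ∈ s, F i e d x := by
  classical
  induction s using Finset.induction_on with
  | empty => simpa using isQuadratic_const (p := p) 0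
  | insert a s ha ih =>
    simp only [Finset.sum_insert ha]
    exact (h a (by simp)).add (ih fun i hi => h i (by simp [hi]))

lemma isQuadratic_linear (c α β γ : ℤ) :
    IsQuadratic p fun e d x => (c : ℚ) + p * (α * e + β * d + γ * x) :=
  ⟨c, α, β, γ, 0, 0, 0, 0, 0, 0, fun _ _ _ => ⟨0, by push_cast; simp⟩⟩

lemma IsQuadratic.congr (hf : IsQuadratic p f) (h : ∀ e d x, PCongr p 3 (g e d x) (f e d x)) :
    IsQuadratic p g := by
  obtain ⟨a₀, a₁, a₂, a₃, a₁₁, a₂₂, a₃₃, a₁₂, a₁₃, a₂₃, ha⟩ := hf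
  refine ⟨a₀, a₁, a₂, a₃, a₁₁, a₂₂, a₃₃, a₁₂, a₁₃, a₂₃, fun e d x => ?_⟩
  obtain ⟨z, hz⟩ := ha e d x
  obtain ⟨w, hw, h⟩ := h e d x
  refine ⟨z + ⟨w, hw⟩, ?_⟩
  rw [sub_eq_iff_eq_add.1 h, hz]
  push_cast
  ring

lemma isQuadratic_linear_inv (hp : p.Prime) {c : ℤ} (hc : IsCoprime c (p : ℤ)) (α β γ : ℤ) :
    IsQuadratic p fun e d x => ((c : ℚ) + p * (α * e + β * d + γ * x))⁻¹ := by
  have hu := isPUnit_int hc hp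
  -- modulo `p³` one has `1 / (c + y) ≡ (1 / c) (1 + w + w²)` for `w = -y / c`
  have hw : IsQuadratic p fun e d x =>
      (((⟨_, hu.2.2⟩ : pIntegral p)) : ℚ) * ((0 : ℤ) + p * ((-α : ℤ) * e + (-β : ℤ) * d +
        (-γ : ℤ) * x)) :=
    (isQuadratic_const _).mul (isQuadratic_linear 0 (-α) (-β) (-γ))
  refine IsQuadratic.congr ((isQuadratic_const ⟨_, hu.2.2⟩).mul
    (((isQuadratic_const 1).add hw).add (hw.mul hw))) fun e d x => ?_
  set y : ℚ := α * e + β * d + γ * x with hy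
  have hym : y ∈ pIntegral p := add_mem (add_mem (mul_mem (intCast_mem_pIntegral α) e.2)
    (mul_mem (intCast_mem_pIntegral β) d.2)) (mul_mem (intCast_mem_pIntegral γ) x.2)
  have hv := isPUnit_int_add hc hp hym
  refine PCongr.of_mul_left hv
    ⟨-(y * (c : ℚ)⁻¹) ^ 3, neg_mem (pow_mem (mul_mem hym hu.2.2) 3), ?_⟩
  have e1 : ((-α : ℤ) * e + (-β : ℤ) * d + (-γ : ℤ) * x : ℚ) = -y := by
    rw [hy]; push_cast; ring
  rw [e1, mul_inv_cancel₀ hv.1]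
  have := hu.1
  push_cast
  field_simp
  ring

lemma isQuadratic_shiftedFactorial (c α β γ : ℤ) (k : ℕ) :
    IsQuadratic p fun e d x => shiftedFactorial (c + p * (α * e + β * d + γ * x)) k := by
  induction k with
  | zero => simpa using isQuadratic_const (p := p) 1
  | succ k ih =>
    simp only [shiftedFactorial_succ]
    refine ih.mul ?_
    have := isQuadratic_linear (p := p) (c + k) α β γ
    push_cast at this
    simpa only [add_right_comm] using this

lemma isQuadratic_shiftedFactorial_inv (hp : p.Prime) {c : ℤ} {k : ℕ}
    (h : ∀ i < k, IsCoprime (c + i) (p : ℤ)) (α β γ : ℤ) :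
    IsQuadratic p fun e d x => (shiftedFactorial (c + p * (α * e + β * d + γ * x)) k)⁻¹ := by
  induction k with
  | zero => simpa using isQuadratic_const (p := p) 1
  | succ k ih =>
    simp only [shiftedFactorial_succ, mul_inv]
    refine (ih fun i hi => h i (by omega)).mul ?_
    have := isQuadratic_linear_inv hp (h k (by omega)) α β γ
    push_cast at this
    simpa only [add_right_comm] using this

lemma isQuadratic_analyticTerm (hp : p.Prime) {m a : ℕ} (hm : m < p) (ha : a < p) (α β : ℤ) :
    IsQuadratic p fun e d x => analyticTerm (p * (α * e + β * d) - m) (p * x) m a := by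
  have cop : ∀ i < m, IsCoprime (-(m : ℤ) + i) (p : ℤ) := fun i hi =>
    isCoprime_of_abs_lt hp (by omega) (by rw [abs_lt]; omega)
  have cop' : ∀ i < a, IsCoprime (1 + (i : ℤ)) (p : ℤ) := fun i hi =>
    isCoprime_of_abs_lt hp (by omega) (by rw [abs_lt]; omega)
  have h1 := isQuadratic_shiftedFactorial (p := p) (-m) α β (-1) m
  have h2 := isQuadratic_shiftedFactorial_inv hp cop α β 1
  have h3 := isQuadratic_shiftedFactorial (p := p) (-m) α β 1 a
  have h4 := isQuadratic_shiftedFactorial (p := p) (1 + m) (-α) (-β) 1 a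
  have h5 := isQuadratic_shiftedFactorial_inv hp cop' 0 0 1
  have h := ((h1.mul h2).mul ((h3.mul h4).mul (h5.mul h5)))
  refine h.congr fun e d x => .of_eq ?_
  unfold analyticTerm shiftTerm
  push_cast
  rw [div_eq_mul_inv, div_eq_mul_inv, sq, mul_inv]
  ring_nf

/-- A quadratic expression modulo `p³` whose dependence on `x` disappears at three affinely
independent parameters does not depend on `x`: the coefficient of `p x` is affine in the
parameters modulo `p²`. -/
lemma IsQuadratic.pcongr_of_nodes (hf : IsQuadratic p f) (x : pIntegral p)
    (h00 : PCongr p 3 (f 0 0 x) (f 0 0 0)) (h10 : PCongr p 3 (f 1 0 x) (f 1 0 0))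
    (h01 : PCongr p 3 (f 0 1 x) (f 0 1 0)) (e d : pIntegral p) :
    PCongr p 3 (f e d x) (f e d 0) := by
  obtain ⟨a₀, a₁, a₂, a₃, a₁₁, a₂₂, a₃₃, a₁₂, a₁₃, a₂₃, ha⟩ := hf
  have key : PCongr p 3 (f e d x - f e d 0) ((1 - e - d) * (f 0 0 x - f 0 0 0) +
      e * (f 1 0 x - f 1 0 0) + d * (f 0 1 x - f 0 1 0)) := by
    obtain ⟨z₁, h₁⟩ := ha e d x
    obtain ⟨z₂, h₂⟩ := ha e d 0
    obtain ⟨z₃, h₃⟩ := ha 0 0 x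
    obtain ⟨z₄, h₄⟩ := ha 0 0 0
    obtain ⟨z₅, h₅⟩ := ha 1 0 x
    obtain ⟨z₆, h₆⟩ := ha 1 0 0
    obtain ⟨z₇, h₇⟩ := ha 0 1 x
    obtain ⟨z₈, h₈⟩ := ha 0 1 0
    refine ⟨_, (z₁ - z₂ - ((1 - e - d) * (z₃ - z₄) + e * (z₅ - z₆) + d * (z₇ - z₈))).2, ?_⟩
    rw [h₁, h₂, h₃, h₄, h₅, h₆, h₇, h₈]
    push_cast
    ring
  rw [← pcongr_sub_zero_iff] at h00 h10 h01 ⊢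
  have h1 := h00.mul_left (sub_mem (sub_mem (one_mem _) e.2) d.2)
  have h2 := h10.mul_left e.2
  have h3 := h01.mul_left d.2
  have h4 := (h1.add h2).add h3
  simp only [mul_zero, add_zero] at h4
  exact key.trans h4

/-- Continuity: `x = p²`, where `p x` vanishes modulo `p³`, gives the value at `x = 0`. -/
lemma IsQuadratic.pcongr_at_sq (hf : IsQuadratic p f) (e d : pIntegral p) :
    PCongr p 3 (f e d (p ^ 2)) (f e d 0) := by
  obtain ⟨a₀, a₁, a₂, a₃, a₁₁, a₂₂, a₃₃, a₁₂, a₁₃, a₂₃, ha⟩ := hf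
  obtain ⟨z₁, h₁⟩ := ha e d (p ^ 2)
  obtain ⟨z₂, h₂⟩ := ha e d 0
  refine ⟨_, (z₁ - z₂ + a₃ + p * (a₃₃ * p ^ 2 + a₁₃ * e + a₂₃ * d)).2, ?_⟩
  rw [h₁, h₂]
  push_cast
  ring

lemma isQuadratic_sum_analyticTerm (hp : p.Prime) {m₁ m₂ : ℕ} (h₁ : m₁ < p) (h₂ : m₂ < p) :
    IsQuadratic p fun e d x => ∑ a ∈ Finset.range p,
      analyticTerm (p * e - m₁) (p * x) m₁ a * analyticTerm (p * d - m₂) (p * x) m₂ a := by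
  refine isQuadratic_sum _ fun a ha => ?_
  rw [Finset.mem_range] at ha
  have q₁ := isQuadratic_analyticTerm hp h₁ ha 1 0
  have q₂ := isQuadratic_analyticTerm hp h₂ ha 0 1
  simpa using q₁.mul q₂

lemma analyticTerm_mem (hp : p.Prime) {m a : ℕ} (hm : m < p) (ha : a < p) {e x : ℚ}
    (he : e ∈ pIntegral p) (hx : x ∈ pIntegral p) :
    analyticTerm (p * e - m) (p * x) m a ∈ pIntegral p := by
  have hp' := natCast_mem_pIntegral (p := p) p
  have hr : p * e - m ∈ pIntegral p := sub_mem (mul_mem hp' he) (natCast_mem_pIntegral m)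
  unfold analyticTerm
  rw [div_eq_mul_inv]
  exact mul_mem (mul_mem (shiftedFactorial_mem (sub_mem hr (mul_mem hp' hx)) m)
    (isPUnit_shiftedFactorial_add hp hm he hx).2.2) (shiftTerm_mem hp hr hx ha)

/-- The reflection `r ↦ 1 - r` takes the integral parameter `p - m` to `-m'`. Both closed forms are
congruent to the same product of block factors, which is invariant under the reflection. -/
lemma analyticTerm_reflect_pcongr (hp : p.Prime) (h5 : 5 ≤ p) {m m' a : ℕ} (hm : p = m + 1 + m')
    (ha : a < p) (n : ℕ) :
    PCongr p 3 (analyticTerm (p * 1 - m) (p * n) m a) (analyticTerm (-m') (p * n) m' a) := by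
  have hn := natCast_mem_pIntegral (p := p) n
  have h1 := prod_blockFactor_pcongr hp h5 hm (one_mem (pIntegral p)) n
  have h2 := prod_blockFactor_pcongr (m := m') (m' := m) hp h5 (by omega)
    (zero_mem (pIntegral p)) n
  have hr : (p * 1 - m : ℚ) = 1 - (p * 0 - m') := by rw [hm]; push_cast; ring
  have hb : ∏ l ∈ Finset.range n, blockFactor (p * 1 - m) (p * l) m m' =
      ∏ l ∈ Finset.range n, blockFactor (p * 0 - m') (p * l) m' m := by
    refine Finset.prod_congr rfl fun l _ => ?_
    rw [hr, blockFactor_one_sub]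
  rw [hb] at h1
  have hs : shiftTerm (p * 1 - m) (p * n) a = shiftTerm (-m') (p * n) a := by
    rw [hr, shiftTerm_one_sub, mul_zero, zero_sub]
  have h3 := (h1.symm.trans h2).mul_left
    (shiftTerm_mem hp (neg_mem (natCast_mem_pIntegral m')) hn ha)
  rw [mul_zero, zero_sub] at h3
  unfold analyticTerm
  rw [hs, mul_comm _ (shiftTerm _ _ _), mul_comm _ (shiftTerm _ _ _)]
  exact h3

/-- For parameters `-m₁` and `-m₂` the closed form of the sum over a block is constant, including
the block at `0`, where its expression as a rational function of `x` degenerates. -/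
lemma sum_analyticTerm_neg_pcongr (hp : p.Prime) (h5 : 5 ≤ p) {m₁ m₂ : ℕ} (h₁ : m₁ < p)
    (h₂ : m₂ < p) (n : ℕ) : PCongr p 3
      (∑ a ∈ Finset.range p,
        analyticTerm (-m₁) (p * n) m₁ a * analyticTerm (-m₂) (p * n) m₂ a)
      (∑ a ∈ Finset.range p, analyticTerm (-m₁) 0 m₁ a * analyticTerm (-m₂) 0 m₂ a) := by
  obtain ⟨K, hK⟩ := exists_sum_analyticTerm_neg_pcongr hp h5 h₁ h₂
  -- the value at `0` agrees with the value at `p³`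
  have h0 := (isQuadratic_sum_analyticTerm hp h₁ h₂).pcongr_at_sq 0 0
  have h2 := hK (p ^ 2) (pow_ne_zero 2 hp.ne_zero)
  push_cast at h0 h2
  simp only [mul_zero, zero_sub] at h0
  rcases eq_or_ne n 0 with rfl | hn
  · simp only [Nat.cast_zero, mul_zero]
    exact .refl _ _
  · exact (hK n hn).trans (h2.symm.trans h0)

/-- The sum over a block, in closed form modulo `p³`, does not depend on the block. -/
lemma sum_analyticTerm_pcongr (hp : p.Prime) (h5 : 5 ≤ p) {m₁ m₁' m₂ m₂' : ℕ}
    (h₁ : p = m₁ + 1 + m₁') (h₂ : p = m₂ + 1 + m₂') (e d : pIntegral p) (n : ℕ) :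
    PCongr p 3
      (∑ a ∈ Finset.range p,
        analyticTerm (p * e - m₁) (p * n) m₁ a * analyticTerm (p * d - m₂) (p * n) m₂ a)
      (∑ a ∈ Finset.range p,
        analyticTerm (p * e - m₁) 0 m₁ a * analyticTerm (p * d - m₂) 0 m₂ a) := by
  have hq := isQuadratic_sum_analyticTerm hp (m₁ := m₁) (m₂ := m₂) (by omega) (by omega)
  have reflect₁ : ∀ n : ℕ, PCongr p 3
      (∑ a ∈ Finset.range p,
        analyticTerm (p * 1 - m₁) (p * n) m₁ a * analyticTerm (-m₂) (p * n) m₂ a)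
      (∑ a ∈ Finset.range p,
        analyticTerm (-m₁') (p * n) m₁' a * analyticTerm (-m₂) (p * n) m₂ a) := by
    intro n
    refine PCongr.sum fun a ha => ?_
    rw [Finset.mem_range] at ha
    rw [mul_comm, mul_comm _ (analyticTerm (-m₂) _ _ _)]
    refine PCongr.mul_left ?_ (analyticTerm_reflect_pcongr hp h5 h₁ ha n)
    have := analyticTerm_mem hp (by omega : m₂ < p) ha (zero_mem _)
      (natCast_mem_pIntegral (p := p) n)
    rwa [mul_zero, zero_sub] at this
  have reflect₂ : ∀ n : ℕ, PCongr p 3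
      (∑ a ∈ Finset.range p,
        analyticTerm (-m₁) (p * n) m₁ a * analyticTerm (p * 1 - m₂) (p * n) m₂ a)
      (∑ a ∈ Finset.range p,
        analyticTerm (-m₁) (p * n) m₁ a * analyticTerm (-m₂') (p * n) m₂' a) := by
    intro n
    refine PCongr.sum fun a ha => ?_
    rw [Finset.mem_range] at ha
    refine PCongr.mul_left ?_ (analyticTerm_reflect_pcongr hp h5 h₂ ha n)
    have := analyticTerm_mem hp (by omega : m₁ < p) ha (zero_mem _)
      (natCast_mem_pIntegral (p := p) n)
    rwa [mul_zero, zero_sub] at this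
  have h00 := sum_analyticTerm_neg_pcongr hp h5 (m₁ := m₁) (m₂ := m₂) (by omega) (by omega) n
  have r₁ := reflect₁ 0
  have r₂ := reflect₂ 0
  rw [Nat.cast_zero, mul_zero] at r₁ r₂
  have h10 := ((reflect₁ n).trans (sum_analyticTerm_neg_pcongr hp h5 (m₁ := m₁') (m₂ := m₂)
    (by omega) (by omega) n)).trans r₁.symm
  have h01 := ((reflect₂ n).trans (sum_analyticTerm_neg_pcongr hp h5 (m₁ := m₁) (m₂ := m₂')
    (by omega) (by omega) n)).trans r₂.symm
  have main := hq.pcongr_of_nodes (n : pIntegral p) (by simpa using h00) (by simpa using h10)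
    (by simpa using h01) e d
  simpa using main

end

/-- For `p ≥ 5` the sum over a block is independent of the block modulo `p³`. -/
lemma FrobeniusData.sum_ratio_pcongr {p : ℕ} {r₁ r₂ : ℚ} (D : FrobeniusData p r₁ r₂) (h5 : 5 ≤ p)
    (n : ℕ) : PCongr p 3 (∑ a ∈ Finset.range p, D.ratio n a)
      (∑ a ∈ Finset.range p, D.ratio 0 a) := by
  have hp := D.prime
  have er₁ : r₁ = p * D.s₁ - D.m₁ := by rw [D.eq₁]; ring
  have er₂ : r₂ = p * D.s₂ - D.m₂ := by rw [D.eq₂]; ring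
  have lt₁ : D.m₁ < p := by have := D.hm₁; omega
  have lt₂ : D.m₂ < p := by have := D.hm₂; omega
  have closed : ∀ n : ℕ, PCongr p 3 (∑ a ∈ Finset.range p, D.ratio n a)
      (∑ a ∈ Finset.range p, analyticTerm (p * D.s₁ - D.m₁) (p * n) D.m₁ a *
        analyticTerm (p * D.s₂ - D.m₂) (p * n) D.m₂ a) := by
    intro n
    refine PCongr.sum fun a ha => ?_
    rw [Finset.mem_range] at ha
    have hn := natCast_mem_pIntegral (p := p) n
    have m₁ := shiftTerm_mem hp D.mem_r₁ hn ha
    have m₂ := shiftTerm_mem hp D.mem_r₂ hn ha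
    have b₁ := (prod_blockFactor_pcongr hp h5 D.hm₁ D.mem₁ n).mul_left (er₁ ▸ m₁)
    have b₂ := (prod_blockFactor_pcongr hp h5 D.hm₂ D.mem₂ n).mul_left (er₂ ▸ m₂)
    have a₁ := analyticTerm_mem hp lt₁ ha D.mem₁ hn
    have a₂ := analyticTerm_mem hp lt₂ ha D.mem₂ hn
    unfold analyticTerm at a₁ a₂ ⊢
    unfold ratio termRatio
    rw [mul_comm] at a₁ a₂
    rw [← er₁] at a₁ b₁ ⊢
    rw [← er₂] at a₂ b₂ ⊢
    have h := b₁.mul (b₂.mem a₂) a₁ b₂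
    convert h using 1 <;> ring
  refine (closed n).trans ?_
  have h0 := closed 0
  rw [Nat.cast_zero, mul_zero] at h0
  exact (sum_analyticTerm_pcongr hp h5 D.hm₁ D.hm₂ ⟨_, D.mem₁⟩ ⟨_, D.mem₂⟩ n).trans h0.symm

/-! ### The primes two and three -/

/-- The shifted factorial of an integer, in a form that evaluates. -/
def risingInt (a : ℤ) : ℕ → ℤ
  | 0 => 1
  | k + 1 => risingInt a k * (a + k)

/-- The integer version of `punctured`. -/
def puncturedInt (y : ℤ) (m m' : ℕ) : ℤ := risingInt y m * risingInt (y + m + 1) m'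

/-- The sum over the block at `x`, multiplied by `(1 + x)_{p - 1}⁴`, for integral parameters. -/
def blockSumInt (p : ℕ) (R₁ R₂ x : ℤ) : ℤ :=
  ∑ a ∈ Finset.range p, risingInt (R₁ + x) a * risingInt (1 - R₁ + x) a *
    (risingInt (R₂ + x) a * risingInt (1 - R₂ + x) a) * risingInt (1 + x + a) (p - 1 - a) ^ 4

/-- The numerator of the deviation between the sums over the blocks `k` and `0`, when the block
factors are congruent to `c`. -/
def blockDeviation (p : ℕ) (R₁ R₂ c : ℤ) (k : ℕ) : ℤ :=
  c ^ k * blockSumInt p R₁ R₂ (p * k) * risingInt 1 (p - 1) ^ 4 -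
    blockSumInt p R₁ R₂ 0 * risingInt (1 + p * k) (p - 1) ^ 4

lemma cast_risingInt (a : ℤ) (k : ℕ) : ((risingInt a k : ℤ) : ℚ) = shiftedFactorial a k := by
  induction k with
  | zero => simp [risingInt]
  | succ k ih => rw [risingInt, shiftedFactorial_succ, ← ih]; push_cast; ring

section
variable {p : ℕ}

lemma PCongr.pow {k : ℕ} {x y : ℚ} (hx : x ∈ pIntegral p) (hy : y ∈ pIntegral p)
    (h : PCongr p k x y) (j : ℕ) : PCongr p k (x ^ j) (y ^ j) := by
  induction j with
  | zero => exact .of_eq (by simp)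
  | succ j ih => rw [pow_succ, pow_succ]; exact ih.mul hx (pow_mem hy j) h

lemma PCongr.shiftedFactorial {k : ℕ} {x y : ℚ} (hx : x ∈ pIntegral p) (hy : y ∈ pIntegral p)
    (h : PCongr p k x y) (j : ℕ) :
    PCongr p k (shiftedFactorial x j) (shiftedFactorial y j) := by
  induction j with
  | zero => exact .of_eq (by simp)
  | succ j ih =>
    rw [shiftedFactorial_succ, shiftedFactorial_succ]
    exact ih.mul (add_mem hx (natCast_mem_pIntegral j)) (shiftedFactorial_mem hy j)
      (h.add (.refl _ _))

lemma pcongr_intCast {k : ℕ} {x y : ℤ} (h : (p : ℤ) ^ k ∣ x - y) : PCongr p k x y := by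
  obtain ⟨c, h⟩ := h
  exact ⟨c, intCast_mem_pIntegral c, by exact_mod_cast h⟩

lemma dvd_of_pcongr_intCast {x : ℤ} (h : PCongr p 1 x 0) : (p : ℤ) ∣ x := by
  obtain ⟨_, ⟨a, b, hb, hbp, rfl⟩, h⟩ := h
  have hb' : (b : ℚ) ≠ 0 := by exact_mod_cast hb
  have h1 : (x * b : ℚ) = p * a := by field_simp at h; linarith
  have h2 : x * b = p * a := by exact_mod_cast h1
  exact hbp.symm.dvd_of_dvd_mul_right ⟨a, h2⟩

/-- For `a > m` the numerator contains the factor `r + p x + m = p (s + x)`. -/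
lemma shiftTerm_pcongr_zero (hp : p.Prime) {r s x : ℚ} {m a : ℕ} (hr : p * s = r + m)
    (hs : s ∈ pIntegral p) (hx : x ∈ pIntegral p) (hm : m < a) (ha : a < p) :
    PCongr p 1 (shiftTerm r (p * x) a) 0 := by
  have hp' := natCast_mem_pIntegral (p := p) p
  have hrm : r ∈ pIntegral p := by
    rw [show r = p * s - m by rw [hr]; ring]
    exact sub_mem (mul_mem hp' hs) (natCast_mem_pIntegral m)
  have hy := add_mem hrm (mul_mem hp' hx)
  have hsplit : shiftedFactorial (r + p * x) a = p * ((s + x) *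
      (shiftedFactorial (r + p * x) m *
        shiftedFactorial (r + p * x + (m + 1 : ℕ)) (a - (m + 1)))) := by
    conv_lhs => rw [show a = m + 1 + (a - (m + 1)) by omega]
    rw [shiftedFactorial_add, shiftedFactorial_succ]
    linear_combination (-(shiftedFactorial (r + p * x) m *
      shiftedFactorial (r + p * x + (m + 1 : ℕ)) (a - (m + 1)))) * hr
  have hu := (isPUnit_shiftedFactorial_one_add hp hx ha).pow 2
  refine ⟨_, mul_mem (mul_mem (mul_mem (add_mem hs hx) (mul_mem (shiftedFactorial_mem hy m)
    (shiftedFactorial_mem (add_mem hy (natCast_mem_pIntegral (m + 1))) (a - (m + 1)))))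
    (shiftedFactorial_mem (add_mem (sub_mem (one_mem _) hrm) (mul_mem hp' hx)) a)) hu.2.2, ?_⟩
  unfold shiftTerm
  rw [hsplit, div_eq_mul_inv]
  ring

end

namespace FrobeniusData
variable {p : ℕ} {r₁ r₂ : ℚ}

/-- The summand at `n` is divisible by `p` as soon as the last base-`p` digit of `n` exceeds one of
the residues `m₁, m₁', m₂, m₂'`. -/
lemma hTerm_pcongr_zero (D : FrobeniusData p r₁ r₂) {n : ℕ}
    (h : D.m₁ < n % p ∨ D.m₁' < n % p ∨ D.m₂ < n % p ∨ D.m₂' < n % p) :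
    PCongr p 1 (hTerm r₁ r₂ n) 0 := by
  have hp := D.prime
  have ha : n % p < p := Nat.mod_lt _ hp.pos
  have hx := natCast_mem_pIntegral (p := p) (n / p)
  have eq₁' : p * (1 - D.s₁) = (1 - r₁) + D.m₁' := by
    have := D.eq₁
    have h' : (p : ℚ) = D.m₁ + 1 + D.m₁' := by exact_mod_cast D.hm₁
    linear_combination h' - this
  have eq₂' : p * (1 - D.s₂) = (1 - r₂) + D.m₂' := by
    have := D.eq₂
    have h' : (p : ℚ) = D.m₂ + 1 + D.m₂' := by exact_mod_cast D.hm₂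
    linear_combination h' - this
  have b₁ : ∏ l ∈ Finset.range (n / p), blockFactor r₁ (p * l) D.m₁ D.m₁' ∈ pIntegral p :=
    prod_mem fun l _ =>
      (isPUnit_blockFactor hp D.hm₁ D.eq₁ D.mem₁ (natCast_mem_pIntegral l)).2.1
  have b₂ : ∏ l ∈ Finset.range (n / p), blockFactor r₂ (p * l) D.m₂ D.m₂' ∈ pIntegral p :=
    prod_mem fun l _ =>
      (isPUnit_blockFactor hp D.hm₂ D.eq₂ D.mem₂ (natCast_mem_pIntegral l)).2.1
  have t₁ := shiftTerm_mem hp D.mem_r₁ hx ha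
  have t₂ := shiftTerm_mem hp D.mem_r₂ hx ha
  have hA := D.hTerm_mem (n / p)
  have key : PCongr p 1 (shiftTerm r₁ (p * (n / p : ℕ)) (n % p)) 0 ∨
      PCongr p 1 (shiftTerm r₂ (p * (n / p : ℕ)) (n % p)) 0 := by
    rcases h with h | h | h | h
    · exact .inl (shiftTerm_pcongr_zero hp D.eq₁ D.mem₁ hx h ha)
    · left
      rw [← shiftTerm_one_sub]
      exact shiftTerm_pcongr_zero hp eq₁' (sub_mem (one_mem _) D.mem₁) hx h ha
    · exact .inr (shiftTerm_pcongr_zero hp D.eq₂ D.mem₂ hx h ha)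
    · right
      rw [← shiftTerm_one_sub]
      exact shiftTerm_pcongr_zero hp eq₂' (sub_mem (one_mem _) D.mem₂) hx h ha
  rw [← Nat.div_add_mod n p, D.hTerm_add]
  unfold ratio termRatio
  rcases key with h | h
  · have h' := h.mul_left (mul_mem (mul_mem hA b₁) (mul_mem b₂ t₂))
    rw [mul_zero] at h'
    convert h' using 1
    ring
  · have h' := h.mul_left (mul_mem (mul_mem hA b₂) (mul_mem b₁ t₁))
    rw [mul_zero] at h'
    convert h' using 1
    ring

/-- The residue `m₁` may be read off from an integer congruent to `r₁`. -/
lemma residue_unique {r s : ℚ} {m₀ m : ℕ} (hs : s ∈ pIntegral p) (hr : p * s = r + m₀)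
    (h₀ : m₀ < p) (hm : m < p) {R : ℤ} (hR : PCongr p 3 r R) (hd : (p : ℤ) ∣ R + m) : m₀ = m := by
  have h1 : PCongr p 1 ((R + m₀ : ℤ) : ℚ) 0 := by
    have e1 : PCongr p 1 (R + m₀ : ℚ) (r + m₀) :=
      (hR.of_le (by norm_num)).symm.add (.refl _ _)
    push_cast
    exact e1.trans ⟨s, hs, by rw [← hr]; ring⟩
  have h2 := dvd_sub (dvd_of_pcongr_intCast h1) hd
  rw [add_sub_add_left_eq_sub] at h2
  have h3 := Int.eq_zero_of_abs_lt_dvd h2 (by rw [abs_lt]; omega)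
  omega

/-- A criterion that can be checked by a finite computation, with the parameters replaced by
integers `R₁, R₂` congruent to them modulo `p³`. The block factors are congruent to a
constant, and the sums over different blocks may differ by multiples of `p²`, as long as the
summand in front is then divisible by `p`. -/
theorem block_pcongr_of_check (D : FrobeniusData p r₁ r₂) (R₁ R₂ c : ℤ) (m₁ m₁' m₂ m₂' : ℕ)
    (hR₁ : PCongr p 3 r₁ R₁) (hR₂ : PCongr p 3 r₂ R₂)
    (hm₁ : p = m₁ + 1 + m₁') (hm₂ : p = m₂ + 1 + m₂')
    (hd₁ : (p : ℤ) ∣ R₁ + m₁) (hd₂ : (p : ℤ) ∣ R₂ + m₂)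
    (hc : ∀ k < p ^ 3, (p : ℤ) ^ 3 ∣
      puncturedInt (R₁ + p * k) m₁ m₁' * puncturedInt (1 - R₁ + p * k) m₁' m₁ *
        (puncturedInt (R₂ + p * k) m₂ m₂' * puncturedInt (1 - R₂ + p * k) m₂' m₂) -
        c * risingInt (1 + p * k) (p - 1) ^ 4)
    (hcp : (p : ℤ) ^ 3 ∣ c ^ p ^ 3 - 1)
    (hG : ∀ k < p ^ 3, (p : ℤ) ^ 3 ∣ blockDeviation p R₁ R₂ c k ∨
      (p : ℤ) ^ 2 ∣ blockDeviation p R₁ R₂ c k ∧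
        (m₁ < k % p ∨ m₁' < k % p ∨ m₂ < k % p ∨ m₂' < k % p)) (n : ℕ) :
    PCongr p 3 (hTerm r₁ r₂ n * ∑ a ∈ Finset.range p, D.ratio n a)
      (hTerm r₁ r₂ n * ∑ a ∈ Finset.range p, D.ratio 0 a) := by
  have hp := D.prime
  have hp' := natCast_mem_pIntegral (p := p) p
  obtain rfl := residue_unique D.mem₁ D.eq₁ (by have := D.hm₁; omega) (by omega) hR₁ hd₁
  obtain rfl := residue_unique D.mem₂ D.eq₂ (by have := D.hm₂; omega) (by omega) hR₂ hd₂
  obtain rfl : D.m₁' = m₁' := by have := D.hm₁; omega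
  obtain rfl : D.m₂' = m₂' := by have := D.hm₂; omega
  have mr₁ := D.mem_r₁
  have mr₂ := D.mem_r₂
  have mR₁ := intCast_mem_pIntegral (p := p) R₁
  have mR₂ := intCast_mem_pIntegral (p := p) R₂
  have mx : ∀ l : ℕ, (p * l : ℚ) ∈ pIntegral p := fun l => mul_mem hp' (natCast_mem_pIntegral l)
  have red : ∀ l : ℕ, PCongr p 3 (p * l : ℚ) (p * (l % p ^ 3 : ℕ) : ℚ) := by
    intro l
    refine PCongr.mul_left hp' ⟨(l / p ^ 3 : ℕ), natCast_mem_pIntegral _, ?_⟩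
    have := Nat.div_add_mod l (p ^ 3)
    have h' : ((p ^ 3 * (l / p ^ 3) + l % p ^ 3 : ℕ) : ℚ) = l := by rw [this]
    push_cast at h' ⊢
    linarith
  -- rising factorials at `r + p l` only depend on the residues of `r` and `l`
  have sf : ∀ {r : ℚ} {R : ℤ}, r ∈ pIntegral p → PCongr p 3 r R → ∀ (l j : ℕ),
      PCongr p 3 (shiftedFactorial (r + p * l) j)
        ((risingInt (R + p * (l % p ^ 3 : ℕ)) j : ℤ) : ℚ) := by
    intro r R hr hR l j
    rw [cast_risingInt]
    push_cast
    exact (hR.add (red l)).shiftedFactorial (add_mem hr (mx l))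
      (add_mem (intCast_mem_pIntegral R) (mx (l % p ^ 3))) j
  have int : ∀ z : ℤ, (z : ℚ) ∈ pIntegral p := fun z => intCast_mem_pIntegral z
  have sfm : ∀ {r : ℚ}, r ∈ pIntegral p → ∀ l j : ℕ,
      shiftedFactorial (r + p * l) j ∈ pIntegral p :=
    fun hr l j => shiftedFactorial_mem (add_mem hr (mx l)) j
  have pun : ∀ {r : ℚ} {R : ℤ}, r ∈ pIntegral p → PCongr p 3 r R → ∀ (l m m' : ℕ),
      PCongr p 3 (punctured (r + p * l) m m')
        ((puncturedInt (R + p * (l % p ^ 3 : ℕ)) m m' : ℤ) : ℚ) := by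
    intro r R hr hR l m m'
    have h1 := sf hr hR l m
    have hR' : PCongr p 3 (r + (m + 1 : ℕ)) ((R + (m + 1 : ℕ) : ℤ) : ℚ) := by
      have := hR.add (.refl 3 ((m + 1 : ℕ) : ℚ))
      push_cast at this ⊢
      exact this
    have h2 := sf (add_mem hr (natCast_mem_pIntegral (m + 1))) hR' l m'
    unfold punctured puncturedInt
    rw [Int.cast_mul]
    have e1 : r + p * l + m + 1 = r + (m + 1 : ℕ) + p * l := by push_cast; ring
    have e2 : R + p * (l % p ^ 3 : ℕ) + m + 1 = R + (m + 1 : ℕ) + p * (l % p ^ 3 : ℕ) := by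
      push_cast; ring
    rw [e1, e2]
    exact h1.mul (h2.mem (int _)) (int _) h2
  have one_sub : ∀ {r : ℚ} {R : ℤ}, PCongr p 3 r R → PCongr p 3 (1 - r) ((1 - R : ℤ) : ℚ) := by
    rintro r R ⟨z, hz, h⟩
    exact ⟨-z, neg_mem hz, by push_cast; linear_combination -h⟩
  have hone : PCongr p 3 (1 : ℚ) ((1 : ℤ) : ℚ) := .of_eq (by simp)
  have m1r₁ := sub_mem (one_mem _) mr₁
  have m1r₂ := sub_mem (one_mem _) mr₂
  have unit : ∀ l : ℕ, IsPUnit p (shiftedFactorial (1 + p * l) (p - 1) ^ 4) := fun l =>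
    (isPUnit_shiftedFactorial_one_add hp (natCast_mem_pIntegral l)
      (by have := hp.pos; omega)).pow 4
  have cunit : ∀ l : ℕ, PCongr p 3 (shiftedFactorial (1 + p * l) (p - 1) ^ 4)
      ((risingInt (1 + p * (l % p ^ 3 : ℕ)) (p - 1) ^ 4 : ℤ) : ℚ) := by
    intro l
    rw [Int.cast_pow]
    exact (sf (one_mem _) hone l (p - 1)).pow (sfm (one_mem _) l _) (int _) 4
  have hlt : ∀ l : ℕ, l % p ^ 3 < p ^ 3 := fun l => Nat.mod_lt _ (pow_pos hp.pos 3)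
  have block : ∀ l : ℕ, PCongr p 3 (blockFactor r₁ (p * l) D.m₁ D.m₁' *
      blockFactor r₂ (p * l) D.m₂ D.m₂') c := by
    intro l
    refine PCongr.of_mul_left (unit l) ?_
    have hnum : shiftedFactorial (1 + p * l) (p - 1) ^ 4 * (blockFactor r₁ (p * l) D.m₁ D.m₁' *
        blockFactor r₂ (p * l) D.m₂ D.m₂') =
        punctured (r₁ + p * l) D.m₁ D.m₁' * punctured (1 - r₁ + p * l) D.m₁' D.m₁ *
        (punctured (r₂ + p * l) D.m₂ D.m₂' * punctured (1 - r₂ + p * l) D.m₂' D.m₂) := by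
      have hne := (isPUnit_shiftedFactorial_one_add hp (natCast_mem_pIntegral l)
        (k := p - 1) (by have := hp.pos; omega)).1
      unfold blockFactor
      rw [show D.m₁ + D.m₁' = p - 1 by omega, show D.m₂ + D.m₂' = p - 1 by omega]
      field_simp
    have a₁ := pun mr₁ hR₁ l D.m₁ D.m₁'
    have a₂ := pun m1r₁ (one_sub hR₁) l D.m₁' D.m₁
    have a₃ := pun mr₂ hR₂ l D.m₂ D.m₂'
    have a₄ := pun m1r₂ (one_sub hR₂) l D.m₂' D.m₂
    have b₁ := a₁.mul (a₂.mem (int _)) (int _) a₂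
    have b₂ := a₃.mul (a₄.mem (int _)) (int _) a₄
    have hb₂ := mul_mem (a₃.mem (int _)) (a₄.mem (int _))
    have h1 := b₁.mul hb₂ (mul_mem (int _) (int _)) b₂
    rw [hnum]
    refine h1.trans ?_
    have h2 := pcongr_intCast (hc _ (hlt l))
    push_cast at h2 ⊢
    refine h2.trans ?_
    have h3 := ((cunit l).mul_left (int c)).symm
    push_cast at h3
    rw [mul_comm _ (c : ℚ)]
    exact h3
  have prods : ∀ n : ℕ, PCongr p 3 ((∏ l ∈ Finset.range n, blockFactor r₁ (p * l) D.m₁ D.m₁') *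
      ∏ l ∈ Finset.range n, blockFactor r₂ (p * l) D.m₂ D.m₂') ((c ^ (n % p ^ 3) : ℤ) : ℚ) := by
    intro n
    rw [← Finset.prod_mul_distrib]
    have h1 : PCongr p 3 (∏ l ∈ Finset.range n, (blockFactor r₁ (p * l) D.m₁ D.m₁' *
        blockFactor r₂ (p * l) D.m₂ D.m₂')) ((c ^ n : ℤ) : ℚ) := by
      induction n with
      | zero => exact .of_eq (by simp)
      | succ n ih =>
        rw [Finset.prod_range_succ, pow_succ, Int.cast_mul]
        exact ih.mul ((block n).mem (int _)) (int _) (block n)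
    refine h1.trans (pcongr_intCast ?_)
    have h2 : c ^ p ^ 3 ≡ 1 [ZMOD (p : ℤ) ^ 3] := (Int.modEq_iff_dvd.2 hcp).symm
    have h3 := (h2.pow (n / p ^ 3)).mul_right (c ^ (n % p ^ 3))
    rw [← pow_mul, ← pow_add, Nat.div_add_mod, one_pow, one_mul] at h3
    exact h3.symm.dvd
  have sums : ∀ n : ℕ, PCongr p 3 (shiftedFactorial (1 + p * n) (p - 1) ^ 4 *
      ∑ a ∈ Finset.range p, shiftTerm r₁ (p * n) a * shiftTerm r₂ (p * n) a)
      ((blockSumInt p R₁ R₂ (p * (n % p ^ 3 : ℕ)) : ℤ) : ℚ) := by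
    intro n
    unfold blockSumInt
    rw [Finset.mul_sum, Int.cast_sum]
    refine PCongr.sum fun a ha => ?_
    rw [Finset.mem_range] at ha
    have hsplit : shiftedFactorial (1 + p * n) (p - 1) =
        shiftedFactorial (1 + p * n) a * shiftedFactorial (1 + a + p * n) (p - 1 - a) := by
      conv_lhs => rw [show p - 1 = a + (p - 1 - a) by omega]
      rw [shiftedFactorial_add, add_right_comm]
    have hne := (isPUnit_shiftedFactorial_one_add hp (natCast_mem_pIntegral n) ha).1
    have hterm : shiftedFactorial (1 + p * n) (p - 1) ^ 4 *
        (shiftTerm r₁ (p * n) a * shiftTerm r₂ (p * n) a) =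
        shiftedFactorial (r₁ + p * n) a * shiftedFactorial (1 - r₁ + p * n) a *
        (shiftedFactorial (r₂ + p * n) a * shiftedFactorial (1 - r₂ + p * n) a) *
        shiftedFactorial (1 + a + p * n) (p - 1 - a) ^ 4 := by
      rw [hsplit]
      unfold shiftTerm
      field_simp
    rw [hterm]
    have a₁ := sf mr₁ hR₁ n a
    have a₂ := sf m1r₁ (one_sub hR₁) n a
    have a₃ := sf mr₂ hR₂ n a
    have a₄ := sf m1r₂ (one_sub hR₂) n a
    have h1a : PCongr p 3 (1 + a : ℚ) ((1 + a : ℤ) : ℚ) := .of_eq (by push_cast; ring)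
    have m1a : (1 + a : ℚ) ∈ pIntegral p := add_mem (one_mem _) (natCast_mem_pIntegral a)
    have a₅ := (sf m1a h1a n (p - 1 - a)).pow (sfm m1a n _) (int _) 4
    have b₁ := a₁.mul (a₂.mem (int _)) (int _) a₂
    have b₂ := a₃.mul (a₄.mem (int _)) (int _) a₄
    have b₃ := b₁.mul (mul_mem (a₃.mem (int _)) (a₄.mem (int _))) (mul_mem (int _) (int _)) b₂
    have b₄ := b₃.mul (pow_mem (sfm m1a n _) 4)
      (mul_mem (mul_mem (int _) (int _)) (mul_mem (int _) (int _))) a₅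
    rw [add_right_comm 1 (_ : ℤ) (a : ℤ)]
    simp only [Int.cast_mul, Int.cast_pow]
    exact b₄
  have total : ∀ n : ℕ, ∑ a ∈ Finset.range p, D.ratio n a =
      ((∏ l ∈ Finset.range n, blockFactor r₁ (p * l) D.m₁ D.m₁') *
        ∏ l ∈ Finset.range n, blockFactor r₂ (p * l) D.m₂ D.m₂') *
      ∑ a ∈ Finset.range p, shiftTerm r₁ (p * n) a * shiftTerm r₂ (p * n) a := by
    intro n
    rw [Finset.mul_sum]
    refine Finset.sum_congr rfl fun a _ => ?_
    unfold ratio termRatio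
    ring
  have weighted : ∀ n : ℕ, PCongr p 3 (shiftedFactorial (1 + p * n) (p - 1) ^ 4 *
      ∑ a ∈ Finset.range p, D.ratio n a)
      ((c ^ (n % p ^ 3) * blockSumInt p R₁ R₂ (p * (n % p ^ 3 : ℕ)) : ℤ) : ℚ) := by
    intro n
    have h := (prods n).mul ((sums n).mem (int _)) (int _) (sums n)
    rw [total, Int.cast_mul]
    convert h using 1
    ring
  -- the deviation, cleared of denominators
  have dev : PCongr p 3 (shiftedFactorial (1 + p * n) (p - 1) ^ 4 *
      shiftedFactorial (1 + p * (0 : ℕ)) (p - 1) ^ 4 *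
      (∑ a ∈ Finset.range p, D.ratio n a - ∑ a ∈ Finset.range p, D.ratio 0 a))
      (blockDeviation p R₁ R₂ c (n % p ^ 3)) := by
    have hw := weighted n
    have hw0 := weighted 0
    have hu := cunit n
    have hu0 := cunit 0
    have h1 := hw.mul (hu0.mem (int _)) (int _) hu0
    have h2 := (hw0.mul (hu.mem (int _)) (int _) hu).mul_left (neg_mem (one_mem _))
    have h3 := h1.add h2
    unfold blockDeviation
    rw [Nat.zero_mod] at h3
    convert h3 using 1
    · ring
    · push_cast
      simp only [mul_zero, add_zero]
      ring
  have conclude : ∀ {j : ℕ}, j ≤ 3 → (p : ℤ) ^ j ∣ blockDeviation p R₁ R₂ c (n % p ^ 3) →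
      PCongr p j (∑ a ∈ Finset.range p, D.ratio n a - ∑ a ∈ Finset.range p, D.ratio 0 a) 0 := by
    intro j hj hd
    refine PCongr.of_mul_left ((unit n).mul (unit 0)) ?_
    rw [mul_zero]
    refine (dev.of_le hj).trans ?_
    have := pcongr_intCast (x := blockDeviation p R₁ R₂ c (n % p ^ 3)) (y := 0) (by simpa using hd)
    simpa using this
  rw [← pcongr_sub_zero_iff, ← mul_sub]
  rcases hG _ (hlt n) with h | ⟨h, hk⟩
  · have := (conclude le_rfl h).mul_left (D.hTerm_mem n)
    rwa [mul_zero] at this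
  · rw [Nat.mod_mod_of_dvd n (dvd_pow_self p three_ne_zero)] at hk
    exact (D.hTerm_pcongr_zero hk).mul_of_zero (conclude (by norm_num) h)

end FrobeniusData

/-! ### Dwork's operation on the admissible parameters -/

/-- `s` is the image of `r` under Dwork's operation: `p s = r + m` with `0 ≤ m < p`. -/
def IsDworkImage (p : ℕ) (r s : ℚ) : Prop :=
  s ∈ pIntegral p ∧ ∃ m m' : ℕ, p = m + 1 + m' ∧ p * s = r + m

lemma isDworkImage_div {p d j k : ℕ} (hp : p.Prime) (hd : 0 < d) (hpd : p.Coprime d) (hk : k < d)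
    (h : p * k % d = j) : IsDworkImage p (j / d) (k / d) := by
  have hdQ : (d : ℚ) ≠ 0 := by positivity
  have hlt : p * k / d < p := by
    rw [Nat.div_lt_iff_lt_mul hd]
    exact Nat.mul_lt_mul_of_pos_left hk hp.pos
  refine ⟨⟨k, d, by exact_mod_cast hd.ne', ?_, by push_cast; rfl⟩, p * k / d,
    p - 1 - p * k / d, by omega, ?_⟩
  · exact Nat.isCoprime_iff_coprime.2 hpd.symm
  · have h1 := Nat.div_add_mod (p * k) d
    rw [h] at h1
    have h2 : ((d * (p * k / d) + j : ℕ) : ℚ) = (p * k : ℕ) := by rw [h1]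
    push_cast at h2
    field_simp
    linarith

lemma FrobeniusData.nonempty_of_images {p : ℕ} (hp : p.Prime) {r₁ r₂ s₁ s₂ : ℚ}
    (h₁ : IsDworkImage p r₁ s₁) (h₂ : IsDworkImage p r₂ s₂)
    (h : ∀ n, hTerm s₁ s₂ n = hTerm r₁ r₂ n) : Nonempty (FrobeniusData p r₁ r₂) := by
  obtain ⟨mem₁, m₁, m₁', hm₁, e₁⟩ := h₁
  obtain ⟨mem₂, m₂, m₂', hm₂, e₂⟩ := h₂
  exact ⟨⟨s₁, s₂, m₁, m₁', m₂, m₂', hp, mem₁, mem₂, e₁, e₂, hm₁, hm₂, h⟩⟩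

lemma coprime_mod {p d : ℕ} (h : p.Coprime d) : Nat.gcd (p % d) d = 1 := by
  rw [← Nat.gcd_rec, Nat.gcd_comm]; exact h

/-- For `d ∈ {2, 3, 4, 6}` the units modulo `d` are `±1`, so that `1 / d` goes to itself or to its
reflection. -/
lemma exists_isDworkImage_of_mem {p : ℕ} (hp : p.Prime) {r : ℚ}
    (hr : r ∈ ({1 / 2, 1 / 3, 1 / 4, 1 / 6} : Set ℚ)) (hpd : p.Coprime r.den) :
    ∃ s, IsDworkImage p r s ∧ ∀ n, pairTerm s n = pairTerm r n := by
  have main : ∀ d : ℕ, 2 ≤ d → p.Coprime d → (p % d = 1 ∨ p % d = d - 1) →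
      ∃ s, IsDworkImage p (1 / d) s ∧ ∀ n, pairTerm s n = pairTerm (1 / d) n := by
    intro d hd hc h
    rcases h with h | h
    · refine ⟨1 / d, ?_, fun _ => rfl⟩
      have := isDworkImage_div (j := 1) (k := 1) hp (by omega) hc (by omega) (by rw [mul_one, h])
      simpa using this
    · refine ⟨1 - 1 / d, ?_, fun n => pairTerm_one_sub _ n⟩
      have hmod : p * (d - 1) % d = 1 := by
        rw [Nat.mul_mod, h, Nat.mod_eq_of_lt (by omega : d - 1 < d)]
        obtain ⟨e, rfl⟩ : ∃ e, d = e + 2 := ⟨d - 2, by omega⟩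
        rw [show (e + 2 - 1) * (e + 2 - 1) = 1 + (e + 2) * e by
          rw [show e + 2 - 1 = e + 1 by omega]; ring, Nat.add_mul_mod_self_left]
        exact Nat.mod_eq_of_lt (by omega)
      have := isDworkImage_div (j := 1) hp (by omega) hc (by omega : d - 1 < d) hmod
      have hdQ : (d : ℚ) ≠ 0 := by positivity
      rw [Nat.cast_sub (by omega), sub_div, Nat.cast_one, div_self hdQ] at this
      exact this
  simp only [Set.mem_insert_iff, Set.mem_singleton_iff] at hr
  rcases hr with rfl | rfl | rfl | rfl
  · have hc : p.Coprime 2 := by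
      rwa [show ((1 / 2 : ℚ)).den = 2 by norm_num] at hpd
    have h1 := coprime_mod hc
    have h2 : p % 2 < 2 := Nat.mod_lt _ (by norm_num)
    exact_mod_cast main 2 le_rfl hc
      (by generalize p % 2 = c at h1 h2; interval_cases c <;> simp_all)
  · have hc : p.Coprime 3 := by
      rwa [show ((1 / 3 : ℚ)).den = 3 by norm_num] at hpd
    have h1 := coprime_mod hc
    have h2 : p % 3 < 3 := Nat.mod_lt _ (by norm_num)
    exact_mod_cast main 3 (by norm_num) hc
      (by generalize p % 3 = c at h1 h2; interval_cases c <;> simp_all)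
  · have hc : p.Coprime 4 := by
      rwa [show ((1 / 4 : ℚ)).den = 4 by norm_num] at hpd
    have h1 := coprime_mod hc
    have h2 : p % 4 < 4 := Nat.mod_lt _ (by norm_num)
    exact_mod_cast main 4 (by norm_num) hc
      (by generalize p % 4 = c at h1 h2; interval_cases c <;> simp_all)
  · have hc : p.Coprime 6 := by
      rwa [show ((1 / 6 : ℚ)).den = 6 by norm_num] at hpd
    have h1 := coprime_mod hc
    have h2 : p % 6 < 6 := Nat.mod_lt _ (by norm_num)
    exact_mod_cast main 6 (by norm_num) hc
      (by generalize p % 6 = c at h1 h2; interval_cases c <;> simp_all)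

/-- The four numerators of an exceptional pair are all the units modulo the denominator, so they
are permuted by the inverse of `p`. -/
lemma FrobeniusData.nonempty_of_numerators {p d j₁ j₂ : ℕ} (hp : p.Prime) (hd : 0 < d)
    (hpd : p.Coprime d) (k₁ k₂ : ℕ) (hk₁ : k₁ < d) (hk₂ : k₂ < d)
    (h₁ : p % d * k₁ % d = j₁) (h₂ : p % d * k₂ % d = j₂)
    (hperm : (k₁ = j₁ ∨ k₁ + j₁ = d) ∧ (k₂ = j₂ ∨ k₂ + j₂ = d) ∨
      (k₁ = j₂ ∨ k₁ + j₂ = d) ∧ (k₂ = j₁ ∨ k₂ + j₁ = d)) :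
    Nonempty (FrobeniusData p (j₁ / d) (j₂ / d)) := by
  rw [Nat.mod_mul_mod] at h₁ h₂
  refine nonempty_of_images hp (isDworkImage_div hp hd hpd hk₁ h₁)
    (isDworkImage_div hp hd hpd hk₂ h₂) fun n => ?_
  have hdQ : (d : ℚ) ≠ 0 := by positivity
  have refl : ∀ {k j : ℕ}, k = j ∨ k + j = d → pairTerm (k / d) n = pairTerm (j / d) n := by
    rintro k j (rfl | h)
    · rfl
    · rw [← pairTerm_one_sub]
      congr 1
      rw [← h] at hdQ ⊢
      push_cast at hdQ ⊢
      field_simp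
      ring
  rcases hperm with ⟨a, b⟩ | ⟨a, b⟩
  · rw [hTerm, refl a, refl b, hTerm]
  · rw [hTerm, refl a, refl b, hTerm, mul_comm]

lemma FrobeniusData.nonempty_of_admissible {p : ℕ} (hp : p.Prime) {r₁ r₂ : ℚ}
    (hr : AdmissiblePair r₁ r₂) (hpd : p.Coprime (commonDen r₁ r₂)) :
    Nonempty (FrobeniusData p r₁ r₂) := by
  have hpd₁ : p.Coprime r₁.den := hpd.coprime_dvd_right (Nat.dvd_lcm_left _ _)
  have hpd₂ : p.Coprime r₂.den := hpd.coprime_dvd_right (Nat.dvd_lcm_right _ _)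
  rcases hr with ⟨h₁, h₂⟩ | h
  · obtain ⟨s₁, i₁, t₁⟩ := exists_isDworkImage_of_mem hp h₁ hpd₁
    obtain ⟨s₂, i₂, t₂⟩ := exists_isDworkImage_of_mem hp h₂ hpd₂
    exact nonempty_of_images hp i₁ i₂ fun n => by rw [hTerm, t₁, t₂, hTerm]
  · simp only [Set.mem_insert_iff, Set.mem_singleton_iff, Prod.mk.injEq] at h
    rcases h with ⟨rfl, rfl⟩ | ⟨rfl, rfl⟩ | ⟨rfl, rfl⟩ | ⟨rfl, rfl⟩
    · have hc : p.Coprime 5 := by rwa [show ((1 / 5 : ℚ)).den = 5 by norm_num] at hpd₁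
      have key := nonempty_of_numerators (j₁ := 1) (j₂ := 2) hp (by norm_num) hc
      have h1 := coprime_mod hc
      have h2 : p % 5 < 5 := Nat.mod_lt _ (by norm_num)
      push_cast at key
      generalize p % 5 = c at h1 h2 key
      interval_cases c
      · simp at h1
      · exact key 1 2 (by norm_num) (by norm_num) rfl rfl (by decide)
      · exact key 3 1 (by norm_num) (by norm_num) rfl rfl (by decide)
      · exact key 2 4 (by norm_num) (by norm_num) rfl rfl (by decide)
      · exact key 4 3 (by norm_num) (by norm_num) rfl rfl (by decide)
    · have hc : p.Coprime 8 := by rwa [show ((1 / 8 : ℚ)).den = 8 by norm_num] at hpd₁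
      have key := nonempty_of_numerators (j₁ := 1) (j₂ := 3) hp (by norm_num) hc
      have h1 := coprime_mod hc
      have h2 : p % 8 < 8 := Nat.mod_lt _ (by norm_num)
      push_cast at key
      generalize p % 8 = c at h1 h2 key
      interval_cases c
      all_goals first
        | exact absurd h1 (by decide)
        | exact key 1 3 (by norm_num) (by norm_num) rfl rfl (by decide)
        | exact key 3 1 (by norm_num) (by norm_num) rfl rfl (by decide)
        | exact key 5 7 (by norm_num) (by norm_num) rfl rfl (by decide)
        | exact key 7 5 (by norm_num) (by norm_num) rfl rfl (by decide)
    · have hc : p.Coprime 10 := by rwa [show ((1 / 10 : ℚ)).den = 10 by norm_num] at hpd₁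
      have key := nonempty_of_numerators (j₁ := 1) (j₂ := 3) hp (by norm_num) hc
      have h1 := coprime_mod hc
      have h2 : p % 10 < 10 := Nat.mod_lt _ (by norm_num)
      push_cast at key
      generalize p % 10 = c at h1 h2 key
      interval_cases c
      all_goals first
        | exact absurd h1 (by decide)
        | exact key 1 3 (by norm_num) (by norm_num) rfl rfl (by decide)
        | exact key 7 1 (by norm_num) (by norm_num) rfl rfl (by decide)
        | exact key 3 9 (by norm_num) (by norm_num) rfl rfl (by decide)
        | exact key 9 7 (by norm_num) (by norm_num) rfl rfl (by decide)
    · have hc : p.Coprime 12 := by rwa [show ((1 / 12 : ℚ)).den = 12 by norm_num] at hpd₁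
      have key := nonempty_of_numerators (j₁ := 1) (j₂ := 5) hp (by norm_num) hc
      have h1 := coprime_mod hc
      have h2 : p % 12 < 12 := Nat.mod_lt _ (by norm_num)
      push_cast at key
      generalize p % 12 = c at h1 h2 key
      interval_cases c
      all_goals first
        | exact absurd h1 (by decide)
        | exact key 1 5 (by norm_num) (by norm_num) rfl rfl (by decide)
        | exact key 5 1 (by norm_num) (by norm_num) rfl rfl (by decide)
        | exact key 7 11 (by norm_num) (by norm_num) rfl rfl (by decide)
        | exact key 11 7 (by norm_num) (by norm_num) rfl rfl (by decide)

/-! ### Finite checks -/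

/-- `j / d ≡ R` modulo `p³` as soon as `p³` divides `R d - j`. -/
lemma div_pcongr_intCast {p : ℕ} (j d : ℕ) {R : ℤ} (hd : 0 < d) (hpd : p.Coprime d)
    (h : (p : ℤ) ^ 3 ∣ j - R * d) : PCongr p 3 (j / d) R := by
  obtain ⟨t, ht⟩ := h
  have hdQ : (d : ℚ) ≠ 0 := by positivity
  refine ⟨t / d, ⟨t, d, by exact_mod_cast hd.ne', Nat.isCoprime_iff_coprime.2 hpd.symm, by
    push_cast; rfl⟩, ?_⟩
  have ht' : (j - R * d : ℚ) = p ^ 3 * t := by exact_mod_cast ht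
  field_simp
  linear_combination ht'

/-- For `p = 2` the admissible pairs with denominators prime to `p` are `(1/3, 1/3)` and
`(1/5, 2/5)`. The block factors are congruent to `1` and `5`, respectively. -/
lemma FrobeniusData.block_pcongr_two {r₁ r₂ : ℚ} (D : FrobeniusData 2 r₁ r₂)
    (hr : AdmissiblePair r₁ r₂) (h₁ : Nat.Coprime 2 r₁.den) (h₂ : Nat.Coprime 2 r₂.den) (n : ℕ) :
    PCongr 2 3 (hTerm r₁ r₂ n * ∑ a ∈ Finset.range 2, D.ratio n a)
      (hTerm r₁ r₂ n * ∑ a ∈ Finset.range 2, D.ratio 0 a) := by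
  have third : PCongr 2 3 (1 / 3) ((3 : ℤ) : ℚ) := by
    exact_mod_cast div_pcongr_intCast 1 3 (R := 3) (by norm_num) (by decide) (by decide)
  have fifth : PCongr 2 3 (1 / 5) ((5 : ℤ) : ℚ) := by
    exact_mod_cast div_pcongr_intCast 1 5 (R := 5) (by norm_num) (by decide) (by decide)
  have fifth' : PCongr 2 3 (2 / 5) ((2 : ℤ) : ℚ) := by
    exact_mod_cast div_pcongr_intCast 2 5 (R := 2) (by norm_num) (by decide) (by decide)
  simp only [AdmissiblePair, Set.mem_insert_iff, Set.mem_singleton_iff, Prod.mk.injEq] at hr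
  rcases hr with ⟨rfl | rfl | rfl | rfl, rfl | rfl | rfl | rfl⟩ |
    ⟨rfl, rfl⟩ | ⟨rfl, rfl⟩ | ⟨rfl, rfl⟩ | ⟨rfl, rfl⟩
  all_goals first
    | (norm_num at h₁; done)
    | (norm_num at h₂; done)
    | exact D.block_pcongr_of_check 3 3 1 1 0 1 0 third third rfl rfl (by decide) (by decide)
        (by decide) (by decide) (by decide) n
    | exact D.block_pcongr_of_check 5 2 5 1 0 0 1 fifth fifth' rfl rfl (by decide) (by decide)
        (by decide) (by decide) (by decide) n

/-- For `p = 3` the denominators prime to `p` are `2`, `4`, `5`, `8` and `10`. The third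
argument of `block_pcongr_of_check` is the residue modulo `27` of the summand at `3` divided by the
summand at `1`. -/
lemma FrobeniusData.block_pcongr_three {r₁ r₂ : ℚ} (D : FrobeniusData 3 r₁ r₂)
    (hr : AdmissiblePair r₁ r₂) (h₁ : Nat.Coprime 3 r₁.den) (h₂ : Nat.Coprime 3 r₂.den) (n : ℕ) :
    PCongr 3 3 (hTerm r₁ r₂ n * ∑ a ∈ Finset.range 3, D.ratio n a)
      (hTerm r₁ r₂ n * ∑ a ∈ Finset.range 3, D.ratio 0 a) := by
  have half : PCongr 3 3 (1 / 2) ((14 : ℤ) : ℚ) := by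
    exact_mod_cast div_pcongr_intCast 1 2 (R := 14) (by norm_num) (by decide) (by decide)
  have quarter : PCongr 3 3 (1 / 4) ((7 : ℤ) : ℚ) := by
    exact_mod_cast div_pcongr_intCast 1 4 (R := 7) (by norm_num) (by decide) (by decide)
  have fifth : PCongr 3 3 (1 / 5) ((11 : ℤ) : ℚ) := by
    exact_mod_cast div_pcongr_intCast 1 5 (R := 11) (by norm_num) (by decide) (by decide)
  have fifth' : PCongr 3 3 (2 / 5) ((22 : ℤ) : ℚ) := by
    exact_mod_cast div_pcongr_intCast 2 5 (R := 22) (by norm_num) (by decide) (by decide)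
  have eighth : PCongr 3 3 (1 / 8) ((17 : ℤ) : ℚ) := by
    exact_mod_cast div_pcongr_intCast 1 8 (R := 17) (by norm_num) (by decide) (by decide)
  have eighth' : PCongr 3 3 (3 / 8) ((24 : ℤ) : ℚ) := by
    exact_mod_cast div_pcongr_intCast 3 8 (R := 24) (by norm_num) (by decide) (by decide)
  have tenth : PCongr 3 3 (1 / 10) ((19 : ℤ) : ℚ) := by
    exact_mod_cast div_pcongr_intCast 1 10 (R := 19) (by norm_num) (by decide) (by decide)
  have tenth' : PCongr 3 3 (3 / 10) ((3 : ℤ) : ℚ) := by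
    exact_mod_cast div_pcongr_intCast 3 10 (R := 3) (by norm_num) (by decide) (by decide)
  simp only [AdmissiblePair, Set.mem_insert_iff, Set.mem_singleton_iff, Prod.mk.injEq] at hr
  rcases hr with ⟨rfl | rfl | rfl | rfl, rfl | rfl | rfl | rfl⟩ |
    ⟨rfl, rfl⟩ | ⟨rfl, rfl⟩ | ⟨rfl, rfl⟩ | ⟨rfl, rfl⟩
  all_goals first
    | (norm_num at h₁; done)
    | (norm_num at h₂; done)
    | exact D.block_pcongr_of_check 14 14 13 1 1 1 1 half half rfl rfl
        (by decide) (by decide) (by decide) (by decide) (by decide) n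
    | exact D.block_pcongr_of_check 14 7 25 1 1 2 0 half quarter rfl rfl
        (by decide) (by decide) (by decide) (by decide) (by decide) n
    | exact D.block_pcongr_of_check 7 14 25 2 0 1 1 quarter half rfl rfl
        (by decide) (by decide) (by decide) (by decide) (by decide) n
    | exact D.block_pcongr_of_check 7 7 19 2 0 2 0 quarter quarter rfl rfl
        (by decide) (by decide) (by decide) (by decide) (by decide) n
    | exact D.block_pcongr_of_check 11 22 7 1 1 2 0 fifth fifth' rfl rfl
        (by decide) (by decide) (by decide) (by decide) (by decide) n
    | exact D.block_pcongr_of_check 17 24 7 1 1 0 2 eighth eighth' rfl rfl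
        (by decide) (by decide) (by decide) (by decide) (by decide) n
    | exact D.block_pcongr_of_check 19 3 10 2 0 0 2 tenth tenth' rfl rfl
        (by decide) (by decide) (by decide) (by decide) (by decide) n

theorem mainTheorem2 (r₁ r₂ : ℚ) (hr : AdmissiblePair r₁ r₂)
    (p : ℕ) (hp : Nat.Prime p) (hpd : Nat.Coprime p (commonDen r₁ r₂))
    (hH : ¬ RatCongr p (truncH r₁ r₂ p) 0) (s : ℕ) (hs : 1 ≤ s) :
    RatCongr (p ^ 3)
      (truncH r₁ r₂ (p ^ (s + 1)) / truncH r₁ r₂ (p ^ s))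
      (truncH r₁ r₂ (p ^ s) / truncH r₁ r₂ (p ^ (s - 1))) := by
  have hpd₁ : p.Coprime r₁.den := hpd.coprime_dvd_right (Nat.dvd_lcm_left _ _)
  have hpd₂ : p.Coprime r₂.den := hpd.coprime_dvd_right (Nat.dvd_lcm_right _ _)
  obtain ⟨D⟩ := FrobeniusData.nonempty_of_admissible hp hr hpd
  refine D.ratCongr_of_block (fun n => ?_) hH s hs
  rcases lt_or_ge p 5 with h5 | h5
  · have h2 := hp.two_le
    interval_cases p
    · exact D.block_pcongr_two hr hpd₁ hpd₂ n
    · exact D.block_pcongr_three hr hpd₁ hpd₂ n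
    · exact absurd hp (by decide)
  · exact (D.sum_ratio_pcongr h5 n).mul_left (D.hTerm_mem n)
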